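/- Let $\Bbbk$ be a field. Let $Q_\infty$ be the quiver with vertex set $\mathbb Z$ and, for every $r\in\mathbb Z$, one arrow $(r|r+1)\colon r\to r+1$ and one arrow $(r|r-1)\colon r\to r-1$. Paths $(i_1|\cdots|i_s)$ are multiplied by concatenation from left to right (the product is $0$ if the endpoints do not match), and $(r)$ is the path of length $0$ at $r$. The infinite zigzag algebra $A$ is the (non-unital) quotient of the path algebra $\Bbbk Q_\infty$ by the relations $$(r|r+1|r+2)=0,\qquad (r|r-1|r-2)=0,\qquad (r|r-1|r)=(r|r+1|r)\qquad (r\in\mathbb Z),$$ graded by $\deg (r)=\deg(r|r+1)=0$, $\deg(r|r-1)=1$. A graded $A$-module is a $\mathbb Z$-graded $\Bbbk$-vector space $M=\bigoplus_j M^j$ with a graded right action of $A$ such that $M=\bigoplus_{r}M(r)$ (equivalently, a graded representation of $Q_\infty$ satisfying the relations, where an arrow $a\to b$ acts from the component at $a$ to the component at $b$). Write $M_r^j$ for the degree $j$ part of $M(r)$. Morphisms are the degree-preserving $A$-linear maps. Let $\mathcal C(A\text{-pmod})$ be the homotopy category of (unbounded) cochain complexes of projective graded $A$-modules: chain maps modulo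 null-homotopic ones. Let $\mathcal M_3$ be the category of tricomplexes, i.e. of trigraded left modules over the exterior algebra on $\partial_1,\partial_2,\partial_3$ over $\Bbbk$: families $(X_{i,j,k})_{(i,j,k)\in\mathbb Z^3}$ of vector spaces with maps $\partial_1,\partial_2,\partial_3$ of tridegrees $(1,0,0),(0,1,0),(0,0,1)$ satisfying $\partial_a^2=0$ and $\partial_a\partial_b+\partial_b\partial_a=0$ for $a\ne b$, with tridegree-preserving maps commuting with the $\partial_a$ as morphisms. Let $\mathcal{SM}_3$ be its stable category: same objects, and morphisms of $\mathcal M_3$ modulo those that factor through a projective object of $\mathcal M_3$. Let $\mathcal G_\infty$ be the functor that sends a complex $(M_k,d)_{k\in\mathbb Z}$ of graded $A$-modules to the tricomplex whose component in tridegree $(i,j,k)$ is $(M_k)_{r}^{j}$ with $r=i-j$, on which $\partial_1$ is the action of $(r|r+1)$, $\partial_2$ is $(-1)^r$ times the action of $(r|r-1)$, and $\partial_3$ is $(-1)^r d$; on chain maps it is the restriction to components. Then $\mathcal G_\infty$, restricted to complexes of projective graded $A$-modules, descends to a unique functor $$\mathcal G\colon \mathcal C(A\text{-pmod})\longrightarrow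 \mathcal{SM}_3,$$ and $\mathcal G$ is fully faithful. -/

import Mathlib

open CategoryTheory

universe u

noncomputable section

namespace Zigzag

/-! ### The infinite zigzag algebra -/

/-- Vertices of the quiver `Q_∞`: the integers (a synonym, so that the order on `ℤ` does not
interfere with the quiver structure). -/
def Vertex : Type := ℤ

instance : DecidableEq Vertex := inferInstanceAs (DecidableEq ℤ)

/-- Arrows of `Q_∞`: one arrow `(r|r+1)` and one arrow `(r|r-1)` out of every vertex `r`. -/
inductive Arrow : ℤ → ℤ → Type
  | right (r : ℤ) : Arrow r (r + 1)
  | left (r : ℤ) : Arrow r (r - 1)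

instance : Quiver.{0} Vertex := ⟨Arrow⟩

/-- The degree of an arrow: `deg (r|r+1) = 0` and `deg (r|r-1) = 1`. -/
def Arrow.degree : ∀ {a b : ℤ}, Arrow a b → ℤ
  | _, _, .right _ => 0
  | _, _, .left _ => 1

/-- The degree of a path: the sum of the degrees of its arrows. -/
def pathDegree {a : Vertex} : ∀ {b : Vertex}, Quiver.Path a b → ℤ
  | _, .nil => 0
  | _, .cons p e => pathDegree p + Arrow.degree e

/-- The semigroup of all paths of `Q_∞` (of any length `≥ 0`) with a zero adjoined. -/
inductive PathSemigroup : Type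
  | zero : PathSemigroup
  | path {a b : Vertex} (p : Quiver.Path a b) : PathSemigroup

namespace PathSemigroup

/-- Concatenation: `(i₁|…|i_r) · (j₁|…|j_s) = (i₁|…|i_r|j₂|…|j_s)` if `i_r = j₁`, and `0`
otherwise. -/
def mul : PathSemigroup → PathSemigroup → PathSemigroup
  | .path (b := b) p, .path (a := c) q =>
      if h : b = c then .path (p.comp (q.cast h.symm rfl)) else .zero
  | _, _ => .zero

instance : Mul PathSemigroup := ⟨mul⟩

@[simp] theorem zero_mul' (x : PathSemigroup) : zero * x = zero := by cases x <;> rfl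

@[simp] theorem mul_zero' (x : PathSemigroup) : x * zero = zero := by cases x <;> rfl

@[simp] theorem path_mul_path {a b c : Vertex} (p : Quiver.Path a b) (q : Quiver.Path b c) :
    path p * path q = path (p.comp q) := dif_pos rfl

theorem path_mul_path_of_ne {a b c d : Vertex} (p : Quiver.Path a b) (q : Quiver.Path c d)
    (h : b ≠ c) : path p * path q = zero := dif_neg h

instance : Semigroup PathSemigroup where
  mul_assoc := by
    rintro (_ | @⟨a, b, p⟩) (_ | @⟨c, d, q⟩) (_ | @⟨e, f, r⟩) <;>
      try simp only [zero_mul', mul_zero']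
    by_cases h : b = c
    · subst h
      by_cases h' : d = e
      · subst h'
        simp
      · rw [path_mul_path_of_ne q r h', path_mul_path, path_mul_path_of_ne _ r h', mul_zero']
    · rw [path_mul_path_of_ne p q h, zero_mul']
      by_cases h' : d = e
      · subst h'
        rw [path_mul_path, path_mul_path_of_ne p _ h]
      · rw [path_mul_path_of_ne q r h', mul_zero']

end PathSemigroup

variable (k : Type u) [Field k]

/-- The semigroup algebra of the paths with zero; the path algebra `k Q_∞` is its quotient by the
line spanned by the zero path. -/
abbrev PreAlgebra : Type u := MonoidAlgebra k PathSemigroup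

/-- The basis element of a path. -/
def ofPath {a b : Vertex} (p : Quiver.Path a b) : PreAlgebra k :=
  MonoidAlgebra.single (PathSemigroup.path p) 1

/-- The arrow `(r|r+1)` as a path. -/
def rightPath (r : ℤ) : Quiver.Path (V := Vertex) r (r + 1 : ℤ) :=
  Quiver.Path.nil.cons (Arrow.right r)

/-- The arrow `(r|r-1)` as a path. -/
def leftPath (r : ℤ) : Quiver.Path (V := Vertex) r (r - 1 : ℤ) :=
  Quiver.Path.nil.cons (Arrow.left r)

/-- The elements that are set equal to zero in `A`: the zero path, `(r|r+1|r+2)`,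
`(r|r-1|r-2)` and `(r|r-1|r) - (r|r+1|r)`. -/
inductive IsRelator : PreAlgebra k → Prop
  | zero_path : IsRelator (MonoidAlgebra.single PathSemigroup.zero 1)
  | right_right (r : ℤ) :
      IsRelator (ofPath k ((rightPath r).cons (Arrow.right (r + 1))))
  | left_left (r : ℤ) :
      IsRelator (ofPath k ((leftPath r).cons (Arrow.left (r - 1))))
  | loops (r : ℤ) :
      IsRelator (ofPath k ((leftPath r).cons (Arrow.right (r - 1))) -
        ofPath k ((rightPath r).cons (Arrow.left (r + 1))))

/-- The two-sided ideal generated by the scalar multiples of the relators. -/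
def relations : TwoSidedIdeal (PreAlgebra k) :=
  TwoSidedIdeal.span {x | ∃ (c : k) (y : PreAlgebra k), IsRelator k y ∧ x = c • y}

/-- The zigzag algebra `A = A_∞` over `k`, a non-unital `k`-algebra. -/
def A : Type u := (relations k).ringCon.Quotient

instance : NonUnitalRing (A k) :=
  inferInstanceAs (NonUnitalRing (relations k).ringCon.Quotient)

theorem relations_smul (c : k) {x y : PreAlgebra k} (h : (relations k).ringCon x y) :
    (relations k).ringCon (c • x) (c • y) := by
  change RingConGen.Rel _ _ _ at h
  change RingConGen.Rel _ _ _
  induction h with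
  | of x y h =>
    obtain ⟨a, z, hz, h⟩ := h
    refine RingConGen.Rel.of _ _ ⟨c * a, z, hz, ?_⟩
    rw [← smul_sub, h, mul_smul]
  | refl x => exact RingConGen.Rel.refl _
  | symm _ ih => exact RingConGen.Rel.symm ih
  | trans _ _ ih₁ ih₂ => exact RingConGen.Rel.trans ih₁ ih₂
  | add _ _ ih₁ ih₂ => rw [smul_add, smul_add]; exact RingConGen.Rel.add ih₁ ih₂
  | mul h₁ h₂ ih₁ ih₂ =>
    rw [← smul_mul_assoc, ← smul_mul_assoc]
    exact RingConGen.Rel.mul ih₁ h₂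

/-- The projection onto `A`, as a function. -/
def A.proj (x : PreAlgebra k) : A k := (x : (relations k).ringCon.Quotient)

theorem A.proj_surjective : Function.Surjective (A.proj k) := Quotient.mk_surjective

instance : SMul k (A k) where
  smul c := Quotient.map' (fun x => c • x) (fun _ _ h => relations_smul k c h)

instance : Module k (A k) where
  one_smul := by
    intro a; obtain ⟨x, rfl⟩ := A.proj_surjective k a
    exact congrArg (A.proj k) (one_smul k x)
  mul_smul := by
    intro c d a; obtain ⟨x, rfl⟩ := A.proj_surjective k a
    exact congrArg (A.proj k) (mul_smul c d x)
  smul_zero c := congrArg (A.proj k) (smul_zero c)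
  smul_add := by
    intro c a b; obtain ⟨x, rfl⟩ := A.proj_surjective k a
    obtain ⟨y, rfl⟩ := A.proj_surjective k b
    exact congrArg (A.proj k) (smul_add c x y)
  add_smul := by
    intro c d a; obtain ⟨x, rfl⟩ := A.proj_surjective k a
    exact congrArg (A.proj k) (add_smul c d x)
  zero_smul := by
    intro a; obtain ⟨x, rfl⟩ := A.proj_surjective k a
    exact congrArg (A.proj k) (zero_smul k x)

/-- The class in `A` of a path. -/
def A.path {a b : Vertex} (p : Quiver.Path a b) : A k := A.proj k (ofPath k p)

/-- The idempotent `(r)`. -/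
def A.e (r : ℤ) : A k := A.path k (Quiver.Path.nil : Quiver.Path (V := Vertex) r r)

/-- The element `(r|r+1)`. -/
def A.right (r : ℤ) : A k := A.path k (rightPath r)

/-- The element `(r|r-1)`. -/
def A.left (r : ℤ) : A k := A.path k (leftPath r)

/-- The homogeneous component of degree `d` of `A`. -/
def A.degree (d : ℤ) : Submodule k (A k) :=
  Submodule.span k {x | ∃ (a b : Vertex) (p : Quiver.Path a b),
    pathDegree p = d ∧ x = A.path k p}

theorem A.path_mem_degree {a b : Vertex} (p : Quiver.Path a b) :
    A.path k p ∈ A.degree k (pathDegree p) :=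
  Submodule.subset_span ⟨a, b, p, rfl, rfl⟩

theorem A.right_mem (r : ℤ) : A.right k r ∈ A.degree k 0 := A.path_mem_degree k (rightPath r)

theorem A.left_mem (r : ℤ) : A.left k r ∈ A.degree k 1 := A.path_mem_degree k (leftPath r)

theorem A.path_mul {a b c : Vertex} (p : Quiver.Path a b) (q : Quiver.Path b c) :
    A.path k p * A.path k q = A.path k (p.comp q) := by
  change A.proj k (ofPath k p * ofPath k q) = _
  unfold A.path
  congr 1
  rw [ofPath, ofPath, MonoidAlgebra.single_mul_single, one_mul, ofPath,
    PathSemigroup.path_mul_path]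

theorem A.right_eq (r : ℤ) : A.right k r * A.e k (r + 1) = A.right k r := A.path_mul k _ _

theorem A.left_eq (r : ℤ) : A.left k r * A.e k (r - 1) = A.left k r := A.path_mul k _ _

theorem A.right_right (r : ℤ) : A.right k r * A.right k (r + 1) = 0 := by
  refine (A.path_mul k _ _).trans (Quotient.sound ?_)
  refine RingConGen.Rel.of _ _ ⟨1, _, IsRelator.right_right r, ?_⟩
  rw [one_smul, sub_zero]; rfl

theorem A.left_left (r : ℤ) : A.left k r * A.left k (r - 1) = 0 := by
  refine (A.path_mul k _ _).trans (Quotient.sound ?_)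
  refine RingConGen.Rel.of _ _ ⟨1, _, IsRelator.left_left r, ?_⟩
  rw [one_smul, sub_zero]; rfl

theorem A.left_right (r : ℤ) :
    A.left k r * A.right k (r - 1) = A.right k r * A.left k (r + 1) := by
  refine (A.path_mul k _ _).trans ((Quotient.sound ?_).trans (A.path_mul k _ _).symm)
  refine RingConGen.Rel.of _ _ ⟨1, _, IsRelator.loops r, ?_⟩
  rw [one_smul]; rfl

/-! ### Graded `A`-modules -/

/-- A graded `A`-module.  Paths of `Q_∞` are multiplied from left to right, and an arrow `a → b`
acts from the component at `a` to the component at `b`; this is a right action, `act x v = v · x`.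
The module is the sum of its components `V · (r)` at the vertices. -/
structure GrMod where
  V : ModuleCat.{u} k
  deg : ℤ → Submodule k V
  isInternal : DirectSum.IsInternal deg
  act : A k →ₗ[k] Module.End k V
  act_mul : ∀ (x y : A k) (v : V), act (x * y) v = act y (act x v)
  act_mem : ∀ {d j : ℤ} {x : A k} {v : V}, x ∈ A.degree k d → v ∈ deg j → act x v ∈ deg (j + d)
  iSup_vertex : ⨆ r : ℤ, LinearMap.range (act (A.e k r)) = ⊤

namespace GrMod

variable {k}

/-- Degree-preserving homomorphisms of graded `A`-modules. -/
@[ext]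
structure Hom (M N : GrMod k) where
  toLin : M.V →ₗ[k] N.V
  map_act : ∀ (x : A k) (v : M.V), toLin (M.act x v) = N.act x (toLin v)
  map_deg : ∀ {j : ℤ} {v : M.V}, v ∈ M.deg j → toLin v ∈ N.deg j

/-- The category `M(A)` of graded `A`-modules. -/
instance : Category (GrMod k) where
  Hom := Hom
  id M := ⟨LinearMap.id, fun _ _ => rfl, fun h => h⟩
  comp f g := ⟨g.toLin ∘ₗ f.toLin, fun x v => by simp [f.map_act, g.map_act],
    fun h => g.map_deg (f.map_deg h)⟩

@[simp] theorem id_toLin (M : GrMod k) : (𝟙 M : M ⟶ M).toLin = LinearMap.id := rfl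

@[simp] theorem comp_toLin {M N P : GrMod k} (f : M ⟶ N) (g : N ⟶ P) :
    (f ≫ g).toLin = g.toLin ∘ₗ f.toLin := rfl

@[ext] theorem hom_ext {M N : GrMod k} {f g : M ⟶ N} (h : f.toLin = g.toLin) : f = g :=
  Hom.ext h

section
variable {M N : GrMod k}

instance : Zero (M ⟶ N) := ⟨⟨0, by simp, by simp⟩⟩
instance : Add (M ⟶ N) := ⟨fun f g => ⟨f.toLin + g.toLin, by simp [f.map_act, g.map_act],
  fun h => add_mem (f.map_deg h) (g.map_deg h)⟩⟩
instance : Neg (M ⟶ N) := ⟨fun f => ⟨-f.toLin, by simp [f.map_act],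
  fun h => neg_mem (f.map_deg h)⟩⟩

@[simp] theorem zero_toLin : (0 : M ⟶ N).toLin = 0 := rfl
@[simp] theorem add_toLin (f g : M ⟶ N) : (f + g).toLin = f.toLin + g.toLin := rfl
@[simp] theorem neg_toLin (f : M ⟶ N) : (-f).toLin = -f.toLin := rfl

instance : AddCommGroup (M ⟶ N) where
  add_assoc _ _ _ := hom_ext (add_assoc _ _ _)
  zero_add _ := hom_ext (zero_add _)
  add_zero _ := hom_ext (add_zero _)
  add_comm _ _ := hom_ext (add_comm _ _)
  neg_add_cancel _ := hom_ext (neg_add_cancel _)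
  nsmul := nsmulRec
  zsmul := zsmulRec

end

instance : Preadditive (GrMod k) where
  add_comp _ _ _ f f' g := by ext v; simp
  comp_add _ _ _ f g g' := by ext v; simp

/-- The component `M_r^j` of `M` at the vertex `r` in degree `j`. -/
def comp (M : GrMod k) (r j : ℤ) : Submodule k M.V :=
  M.deg j ⊓ LinearMap.range (M.act (A.e k r))

theorem act_right_mem (M : GrMod k) {r s j : ℤ} (hs : s = r + 1) {v : M.V}
    (hv : v ∈ M.comp r j) : M.act (A.right k r) v ∈ M.comp s j := by
  subst hs
  refine ⟨?_, M.act (A.right k r) v, ?_⟩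
  · simpa using M.act_mem (A.right_mem k r) hv.1
  · rw [← M.act_mul, A.right_eq]

theorem act_left_mem (M : GrMod k) {r s j : ℤ} (hs : s = r - 1) {v : M.V}
    (hv : v ∈ M.comp r j) : M.act (A.left k r) v ∈ M.comp s (j + 1) := by
  subst hs
  refine ⟨M.act_mem (A.left_mem k r) hv.1, M.act (A.left k r) v, ?_⟩
  rw [← M.act_mul, A.left_eq]

theorem Hom.map_comp {M N : GrMod k} (f : M ⟶ N) {r j : ℤ} {v : M.V}
    (hv : v ∈ M.comp r j) : f.toLin v ∈ N.comp r j := by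
  obtain ⟨h, w, rfl⟩ := hv
  exact ⟨f.map_deg h, f.toLin w, (f.map_act _ _).symm⟩

end GrMod

/-! ### Tricomplexes -/

/-- A tricomplex over `k`: a trigraded left module over the exterior algebra `Λ_3` on
`∂₁, ∂₂, ∂₃`, given by its homogeneous components and the action of the three generators. -/
structure Tricomplex where
  X : ℤ → ℤ → ℤ → ModuleCat.{u} k
  d₁ : ∀ i j l, X i j l →ₗ[k] X (i + 1) j l
  d₂ : ∀ i j l, X i j l →ₗ[k] X i (j + 1) l
  d₃ : ∀ i j l, X i j l →ₗ[k] X i j (l + 1)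
  d₁_d₁ : ∀ i j l x, d₁ (i + 1) j l (d₁ i j l x) = 0
  d₂_d₂ : ∀ i j l x, d₂ i (j + 1) l (d₂ i j l x) = 0
  d₃_d₃ : ∀ i j l x, d₃ i j (l + 1) (d₃ i j l x) = 0
  d₁_d₂ : ∀ i j l x, d₁ i (j + 1) l (d₂ i j l x) + d₂ (i + 1) j l (d₁ i j l x) = 0
  d₁_d₃ : ∀ i j l x, d₁ i j (l + 1) (d₃ i j l x) + d₃ (i + 1) j l (d₁ i j l x) = 0
  d₂_d₃ : ∀ i j l x, d₂ i j (l + 1) (d₃ i j l x) + d₃ i (j + 1) l (d₂ i j l x) = 0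

namespace Tricomplex

variable {k}

/-- Morphisms of tricomplexes: tridegree-preserving maps commuting with `∂₁, ∂₂, ∂₃`. -/
@[ext]
structure Hom (M N : Tricomplex k) where
  f : ∀ i j l, M.X i j l →ₗ[k] N.X i j l
  comm₁ : ∀ i j l x, f (i + 1) j l (M.d₁ i j l x) = N.d₁ i j l (f i j l x)
  comm₂ : ∀ i j l x, f i (j + 1) l (M.d₂ i j l x) = N.d₂ i j l (f i j l x)
  comm₃ : ∀ i j l x, f i j (l + 1) (M.d₃ i j l x) = N.d₃ i j l (f i j l x)

/-- The category `M_3` of tricomplexes. -/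
instance : Category (Tricomplex k) where
  Hom := Hom
  id M := ⟨fun _ _ _ => LinearMap.id, fun _ _ _ _ => rfl, fun _ _ _ _ => rfl, fun _ _ _ _ => rfl⟩
  comp f g := ⟨fun i j l => g.f i j l ∘ₗ f.f i j l, by simp [f.comm₁, g.comm₁],
    by simp [f.comm₂, g.comm₂], by simp [f.comm₃, g.comm₃]⟩

@[simp] theorem id_f (M : Tricomplex k) (i j l : ℤ) :
    (𝟙 M : M ⟶ M).f i j l = LinearMap.id := rfl

@[simp] theorem comp_f {M N P : Tricomplex k} (f : M ⟶ N) (g : N ⟶ P) (i j l : ℤ) :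
    (f ≫ g).f i j l = g.f i j l ∘ₗ f.f i j l := rfl

@[ext] theorem hom_ext {M N : Tricomplex k} {f g : M ⟶ N}
    (h : ∀ i j l, f.f i j l = g.f i j l) : f = g :=
  Hom.ext (by funext i j l; exact h i j l)

section
variable {M N : Tricomplex k}

instance : Zero (M ⟶ N) := ⟨⟨fun _ _ _ => 0, by simp, by simp, by simp⟩⟩
instance : Add (M ⟶ N) := ⟨fun f g => ⟨fun i j l => f.f i j l + g.f i j l,
  by simp [f.comm₁, g.comm₁], by simp [f.comm₂, g.comm₂], by simp [f.comm₃, g.comm₃]⟩⟩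
instance : Neg (M ⟶ N) := ⟨fun f => ⟨fun i j l => -f.f i j l,
  by simp [f.comm₁], by simp [f.comm₂], by simp [f.comm₃]⟩⟩

@[simp] theorem zero_f (i j l : ℤ) : (0 : M ⟶ N).f i j l = 0 := rfl
@[simp] theorem add_f (f g : M ⟶ N) (i j l : ℤ) : (f + g).f i j l = f.f i j l + g.f i j l := rfl
@[simp] theorem neg_f (f : M ⟶ N) (i j l : ℤ) : (-f).f i j l = -f.f i j l := rfl

instance : AddCommGroup (M ⟶ N) where
  add_assoc _ _ _ := hom_ext fun _ _ _ => add_assoc _ _ _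
  zero_add _ := hom_ext fun _ _ _ => zero_add _
  add_zero _ := hom_ext fun _ _ _ => add_zero _
  add_comm _ _ := hom_ext fun _ _ _ => add_comm _ _
  neg_add_cancel _ := hom_ext fun _ _ _ => neg_add_cancel _
  nsmul := nsmulRec
  zsmul := zsmulRec

end

instance : Preadditive (Tricomplex k) where
  add_comp _ _ _ f f' g := by ext i j l v; simp
  comp_add _ _ _ f g g' := by ext i j l v; simp

/-- Two morphisms are stably equal if their difference factors through a projective object
of `M_3`. -/
def stableRel : HomRel (Tricomplex k) := fun M N f g =>
  ∃ (P : Tricomplex k) (_ : Projective P) (a : M ⟶ P) (b : P ⟶ N), f - g = a ≫ b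

end Tricomplex

/-- The stable category `SM_3` of tricomplexes: the objects are those of `M_3`, the morphisms are
the morphisms of `M_3` modulo those that factor through a projective object. -/
abbrev SM3 : Type (u + 1) := CategoryTheory.Quotient (Tricomplex.stableRel (k := k))

/-- The projection functor `M_3 ⥤ SM_3`. -/
abbrev SM3.quotient : Tricomplex k ⥤ SM3 k := CategoryTheory.Quotient.functor _

/-! ### Complexes of graded projective modules and their homotopy category -/

/-- (Unbounded) cochain complexes of graded `A`-modules. -/
abbrev Cx : Type (u + 1) := CochainComplex (GrMod k) ℤ

/-- The complexes all of whose terms are graded projective `A`-modules. -/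
def termwiseProjective : ObjectProperty (Cx k) := fun M => ∀ n : ℤ, Projective (M.X n)

/-- The category of complexes of graded projective `A`-modules and chain maps. -/
abbrev ProjCx : Type (u + 1) := (termwiseProjective k).FullSubcategory

/-- The homotopy category `C(A-pmod)` of complexes of graded projective `A`-modules: the full
subcategory of the homotopy category `C(A)` of complexes of graded `A`-modules. -/
abbrev HoProj : Type (u + 1) :=
  ObjectProperty.FullSubcategory
    (fun M : HomotopyCategory (GrMod k) (ComplexShape.up ℤ) => termwiseProjective k M.as)

/-- The projection functor from complexes of graded projectives to `C(A-pmod)`. -/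
def HoProj.quotient : ProjCx k ⥤ HoProj k :=
  ObjectProperty.lift _ ((termwiseProjective k).ι ⋙ HomotopyCategory.quotient _ _)
    (fun M => M.property)

/-! ### The functor from complexes of graded `A`-modules to tricomplexes -/

variable {k}

/-- The tricomplex of a complex `M` of graded `A`-modules.  The component of `M_l` at the vertex
`r` in degree `j` is placed in tridegree `(r + j, j, l)`; writing `r = i - j`, on the component in
tridegree `(i, j, l)` the generator `∂₁` is the action of `(r|r+1)`, `∂₂` is `(-1)^r` times the
action of `(r|r-1)`, and `∂₃` is `(-1)^r` times the differential of `M`. -/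
def GinfObj (M : Cx k) : Tricomplex k where
  X i j l := ModuleCat.of k ((M.X l).comp (i - j) j)
  d₁ i j l := ((M.X l).act (A.right k (i - j))).restrict
    (fun _ hv => (M.X l).act_right_mem (by ring) hv)
  d₂ i j l := (i - j).negOnePow • ((M.X l).act (A.left k (i - j))).restrict
    (fun _ hv => (M.X l).act_left_mem (by ring) hv)
  d₃ i j l := (i - j).negOnePow • (M.d l (l + 1)).toLin.restrict
    (fun _ hv => GrMod.Hom.map_comp (M.d l (l + 1)) hv)
  d₁_d₁ i j l x := by
    apply Subtype.ext
    have h : i + 1 - j = (i - j) + 1 := by ring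
    simp only [LinearMap.coe_restrict_apply, h, ← GrMod.act_mul, A.right_right]
    simp
  d₂_d₂ i j l x := by
    apply Subtype.ext
    have h : i - (j + 1) = (i - j) - 1 := by ring
    simp only [LinearMap.smul_apply, Submodule.coe_smul_of_tower,
      LinearMap.coe_restrict_apply, h, Units.smul_def, map_zsmul]
    simp [← GrMod.act_mul, A.left_left]
  d₃_d₃ i j l x := by
    apply Subtype.ext
    have h := DFunLike.congr_fun (congrArg GrMod.Hom.toLin (M.d_comp_d l (l + 1) (l + 1 + 1)))
      x.1
    simp only [GrMod.comp_toLin, LinearMap.comp_apply, GrMod.zero_toLin] at h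
    simp [h]
  d₁_d₂ i j l x := by
    apply Subtype.ext
    have h : i + 1 - j = (i - j) + 1 := by ring
    have h' : i - (j + 1) = (i - j) - 1 := by ring
    simp only [LinearMap.smul_apply, Submodule.coe_add, Submodule.coe_smul_of_tower,
      LinearMap.coe_restrict_apply, h, h', Int.negOnePow_succ, Units.smul_def, map_zsmul,
      ← GrMod.act_mul]
    rw [A.left_right]
    simp
  d₁_d₃ i j l x := by
    apply Subtype.ext
    have h : i + 1 - j = (i - j) + 1 := by ring
    simp only [LinearMap.smul_apply, Submodule.coe_add, Submodule.coe_smul_of_tower,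
      LinearMap.coe_restrict_apply, h, Int.negOnePow_succ, Units.smul_def, map_zsmul,
      GrMod.Hom.map_act]
    simp
  d₂_d₃ i j l x := by
    apply Subtype.ext
    have h' : (i - (j + 1)).negOnePow = -(i - j).negOnePow := by
      rw [← Int.negOnePow_succ, Int.negOnePow_eq_iff]
      exact ⟨-1, by ring⟩
    simp only [LinearMap.smul_apply, Submodule.coe_add, Submodule.coe_smul_of_tower,
      LinearMap.coe_restrict_apply, h', Units.smul_def, map_zsmul]
    rw [GrMod.Hom.map_act]
    simp

variable (k)

/-- The functor `G_∞` from complexes of graded `A`-modules to tricomplexes. -/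
def Ginf : Cx k ⥤ Tricomplex k where
  obj M := GinfObj M
  map {M N} f :=
    { f := fun i j l => (f.f l).toLin.restrict (fun _ hv => GrMod.Hom.map_comp (f.f l) hv)
      comm₁ := fun i j l x => Subtype.ext ((f.f l).map_act _ _)
      comm₂ := fun i j l x => Subtype.ext (by
        change (f.f l).toLin ((i - j).negOnePow • (M.X l).act (A.left k (i - j)) x.1) =
          (i - j).negOnePow • (N.X l).act (A.left k (i - j)) ((f.f l).toLin x.1)
        rw [Units.smul_def, Units.smul_def, map_zsmul, (f.f l).map_act])
      comm₃ := fun i j l x => Subtype.ext (by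
        have h := DFunLike.congr_fun (congrArg GrMod.Hom.toLin (f.comm l (l + 1))) x.1
        change (f.f (l + 1)).toLin ((i - j).negOnePow • (M.d l (l + 1)).toLin x.1) =
          (i - j).negOnePow • (N.d l (l + 1)).toLin ((f.f l).toLin x.1)
        rw [Units.smul_def, Units.smul_def, map_zsmul]
        exact congrArg _ h.symm) }
  map_id M := rfl
  map_comp f g := rfl

end Zigzag

end

noncomputable section

namespace Zigzag

/-! For a fixed third index, a row of a tricomplex with its anticommuting `∂₁`, `∂₂` is the same
thing as a graded `A`-module: tridegree `(i, j, l)` sits at the vertex `i - j` in degree `j`, and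
twisting `∂₂` by `(-1)^(i-j)` turns anticommutation into `(r|r-1|r) = (r|r+1|r)`. With the same
twist on `∂₃`, morphisms between the tricomplexes of two complexes are exactly the chain maps, so
`Ginf` is full (`GinfObj.exists_map_eq`). What remains is to match null-homotopy with factoring
through a projective.

The bridge is `Tricomplex.Null`: a contraction in the direction of `∂₃` by maps that anticommute
with `∂₁` and `∂₂`. Up to the sign `(-1)^(i-j)` such contractions are chain homotopies
(`null_of_homotopy`, `homotopy_of_null`).

Stably zero implies null: `ind Y`, which is free over `∂₃` on the rows of `Y`, maps onto `Y`. A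
morphism from a projective to `Y` lifts to `ind Y`, and everything that passes through `ind Y` is
null, the second coordinate being the contraction (`Null.of_projective`). This gives faithfulness.

Null implies stably zero: a null morphism out of `X` factors through `X ⟶ coind X`. As `coind X` is
also free over `∂₃`, on the shifted rows of `X`, it is projective once these rows lift along
epimorphisms (`RowLifting.projective_coind`). For the tricomplex of a complex of projectives they
do: `Tot` makes a row of an arbitrary tricomplex into a graded `A`-module, and an epimorphism of
tricomplexes into one of graded modules (`exists_lift_row`). This gives the descent to the homotopy
category. The descended functor is unique because the projection to the homotopy category is full
and hits every object. -/

variable (k : Type u) [Field k]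

/-! ### Paths and generators of the zigzag algebra -/

/-- The projection onto `A`, as a linear map. -/
def A.projLin : PreAlgebra k →ₗ[k] A k where
  toFun := A.proj k
  map_add' _ _ := rfl
  map_smul' _ _ := rfl

theorem A.proj_zero_path : A.proj k (MonoidAlgebra.single PathSemigroup.zero 1) = 0 := by
  refine Quotient.sound (RingConGen.Rel.of _ _ ⟨1, _, IsRelator.zero_path, ?_⟩)
  rw [one_smul, sub_zero]

theorem A.path_mul_of_ne {a b c d : Vertex} (p : Quiver.Path a b) (q : Quiver.Path c d)
    (h : b ≠ c) : A.path k p * A.path k q = 0 := by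
  rw [← A.proj_zero_path]
  change A.proj k (ofPath k p * ofPath k q) = _
  rw [ofPath, ofPath, MonoidAlgebra.single_mul_single, one_mul,
    PathSemigroup.path_mul_path_of_ne p q h]

theorem A.e_mul_e (r : ℤ) : A.e k r * A.e k r = A.e k r := A.path_mul k _ _

theorem A.e_mul_e_of_ne {r s : ℤ} (h : r ≠ s) : A.e k r * A.e k s = 0 :=
  A.path_mul_of_ne k _ _ h

theorem A.e_mul_right (r : ℤ) : A.e k r * A.right k r = A.right k r := A.path_mul k _ _

theorem A.e_mul_left (r : ℤ) : A.e k r * A.left k r = A.left k r := A.path_mul k _ _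

theorem A.e_mem (r : ℤ) : A.e k r ∈ A.degree k 0 :=
  A.path_mem_degree k (Quiver.Path.nil : Quiver.Path (V := Vertex) r r)

theorem A.span_path : Submodule.span k
    {x : A k | ∃ (a b : Vertex) (p : Quiver.Path a b), x = A.path k p} = ⊤ := by
  rw [eq_top_iff]
  rintro x -
  obtain ⟨y, rfl⟩ := A.proj_surjective k x
  change A.projLin k y ∈ _
  induction y using MonoidAlgebra.induction_linear with
  | zero => rw [map_zero]; exact zero_mem _
  | add f g hf hg => rw [map_add]; exact add_mem hf hg
  | single s c =>
    have h : (MonoidAlgebra.single s c : PreAlgebra k) = c • MonoidAlgebra.single s 1 := by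
      simp
    rw [h, map_smul]
    refine Submodule.smul_mem _ _ ?_
    rcases s with _ | @⟨a, b, p⟩
    · change A.proj k _ ∈ _
      rw [A.proj_zero_path]
      exact zero_mem _
    · exact Submodule.subset_span ⟨a, b, p, rfl⟩

/-- Inductive step for `A.eq_top_of_closed`; the endpoints of the arrow are typed as integers so
that it can be split into its two kinds. -/
theorem A.path_cons_mem (S : Submodule k (A k)) (hr : ∀ r, A.right k r ∈ S)
    (hl : ∀ r, A.left k r ∈ S) (hmul : ∀ x ∈ S, ∀ y ∈ S, x * y ∈ S) {a : Vertex} {b c : ℤ}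
    (p : Quiver.Path (V := Vertex) a b) (e : Arrow b c) (hp : A.path k p ∈ S) :
    A.path k (Quiver.Path.cons (V := Vertex) p e) ∈ S := by
  cases e with
  | right => exact A.path_mul k p (rightPath b) ▸ hmul _ hp _ (hr b)
  | left => exact A.path_mul k p (leftPath b) ▸ hmul _ hp _ (hl b)

/-- A subspace of `A` closed under products that contains the idempotents and the arrows is
everything. -/
theorem A.eq_top_of_closed (S : Submodule k (A k)) (he : ∀ r, A.e k r ∈ S)
    (hr : ∀ r, A.right k r ∈ S) (hl : ∀ r, A.left k r ∈ S)
    (hmul : ∀ x ∈ S, ∀ y ∈ S, x * y ∈ S) : S = ⊤ := by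
  rw [eq_top_iff, ← A.span_path, Submodule.span_le]
  rintro _ ⟨a, b, p, rfl⟩
  induction p with
  | nil => exact he _
  | cons p e ih =>
    exact A.path_cons_mem k S hr hl hmul p e ih

/-! ### Components of graded modules and gluing of maps -/

variable {k}

/-- The ranges of a family of orthogonal idempotents that span form a direct sum
decomposition. -/
theorem isInternal_range_of_idempotents {ι V : Type*} [DecidableEq ι] [AddCommGroup V]
    [Module k V] (P : ι → Module.End k V) (hP : ∀ i, P i ∘ₗ P i = P i)
    (hne : ∀ i j, i ≠ j → P i ∘ₗ P j = 0) (htop : ⨆ i, LinearMap.range (P i) = ⊤) :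
    DirectSum.IsInternal fun i => LinearMap.range (P i) := by
  rw [DirectSum.isInternal_submodule_iff_iSupIndep_and_iSup_eq_top]
  refine ⟨?_, htop⟩
  rw [iSupIndep_def]
  intro i
  rw [Submodule.disjoint_def]
  rintro _ ⟨v, rfl⟩ hv
  have h : ⨆ j, ⨆ (_ : j ≠ i), LinearMap.range (P j) ≤ LinearMap.ker (P i) := by
    refine iSup₂_le fun j hj => ?_
    rintro _ ⟨w, rfl⟩
    exact DFunLike.congr_fun (hne i j hj.symm) w
  have := h hv
  rw [LinearMap.mem_ker] at this
  rw [← this]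
  exact (DFunLike.congr_fun (hP i) v).symm

namespace GrMod

variable (M N : GrMod k)

theorem act_e_act_e (r : ℤ) (v : M.V) :
    M.act (A.e k r) (M.act (A.e k r) v) = M.act (A.e k r) v := by
  rw [← M.act_mul, A.e_mul_e]

theorem act_e_act_e_of_ne {r s : ℤ} (h : r ≠ s) (v : M.V) :
    M.act (A.e k s) (M.act (A.e k r) v) = 0 := by
  rw [← M.act_mul, A.e_mul_e_of_ne k h, map_zero, LinearMap.zero_apply]

theorem act_e_of_mem {r j : ℤ} {v : M.V} (hv : v ∈ M.comp r j) : M.act (A.e k r) v = v := by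
  obtain ⟨-, w, rfl⟩ := hv
  exact M.act_e_act_e r w

theorem act_e_of_mem_of_ne {r s j : ℤ} (h : r ≠ s) {v : M.V} (hv : v ∈ M.comp r j) :
    M.act (A.e k s) v = 0 := by
  obtain ⟨-, w, rfl⟩ := hv
  exact M.act_e_act_e_of_ne h w

theorem act_right_of_mem_of_ne {r s j : ℤ} (h : r ≠ s) {v : M.V} (hv : v ∈ M.comp r j) :
    M.act (A.right k s) v = 0 := by
  rw [← A.e_mul_right, M.act_mul, M.act_e_of_mem_of_ne h hv, map_zero]

theorem act_left_of_mem_of_ne {r s j : ℤ} (h : r ≠ s) {v : M.V} (hv : v ∈ M.comp r j) :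
    M.act (A.left k s) v = 0 := by
  rw [← A.e_mul_left, M.act_mul, M.act_e_of_mem_of_ne h hv, map_zero]

theorem act_e_mem_deg (r : ℤ) {j : ℤ} {v : M.V} (hv : v ∈ M.deg j) :
    M.act (A.e k r) v ∈ M.deg j := by
  simpa using M.act_mem (A.e_mem k r) hv

/-- The idempotent `(r)` has degree 0, so it carries the homogeneous parts of a vector of `M(r)`
into components. The pair `(i, j)` indexes vertex `i - j` and degree `j`, as in a tricomplex. -/
theorem iSup_comp : ⨆ p : ℤ × ℤ, M.comp (p.1 - p.2) p.2 = ⊤ := by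
  rw [eq_top_iff, ← M.iSup_vertex]
  refine iSup_le fun r => ?_
  rintro _ ⟨v, rfl⟩
  have hv : v ∈ ⨆ j, M.deg j := by rw [M.isInternal.submodule_iSup_eq_top]; trivial
  induction hv using Submodule.iSup_induction' with
  | mem j v hv =>
    refine Submodule.mem_iSup_of_mem (r + j, j) ⟨M.act_e_mem_deg r hv, v, ?_⟩
    simp
  | zero => rw [map_zero]; exact zero_mem _
  | add v w _ _ h h' => rw [map_add]; exact add_mem h h'

theorem deg_le_iSup_comp (j : ℤ) : M.deg j ≤ ⨆ r : ℤ, M.comp r j := by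
  intro v hv
  have h : (⊤ : Submodule k M.V) ≤ (⨆ r : ℤ, M.comp r j) ⊔ ⨆ j', ⨆ (_ : j' ≠ j), M.deg j' := by
    rw [← M.iSup_comp]
    refine iSup_le fun p => ?_
    by_cases hp : p.2 = j
    · subst hp
      exact le_sup_of_le_left (le_iSup (fun r => M.comp r p.2) (p.1 - p.2))
    · exact le_sup_of_le_right (inf_le_left.trans
        (le_iSup₂ (f := fun j' (_ : j' ≠ j) => M.deg j') p.2 hp))
  -- Split `v = c + w` with `c` from the components of degree `j` and `w` from the other degrees.
  -- Then `w = v - c` also has degree `j`, so it vanishes.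
  obtain ⟨c, hc, w, hw, rfl⟩ := Submodule.mem_sup.1 (h (Submodule.mem_top (x := v)))
  have hcj : c ∈ M.deg j := (iSup_le fun r => inf_le_left : ⨆ r : ℤ, M.comp r j ≤ M.deg j) hc
  have hd := M.isInternal.submodule_iSupIndep
  rw [iSupIndep_def] at hd
  have hw0 : w = 0 := Submodule.disjoint_def.1 (hd j) w
    (by simpa using sub_mem hv hcj) hw
  rwa [hw0, add_zero]

/-- The idempotent at `i - j` fixes the component `(i, j)`, kills those at other vertices and
preserves degrees. Independence of the components therefore reduces to that of the degrees. -/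
theorem iSupIndep_comp : iSupIndep fun p : ℤ × ℤ => M.comp (p.1 - p.2) p.2 := by
  rw [iSupIndep_def]
  rintro ⟨i, j⟩
  rw [Submodule.disjoint_def]
  intro v hv hv'
  have hd := M.isInternal.submodule_iSupIndep
  rw [iSupIndep_def] at hd
  refine (Submodule.disjoint_def.1 (hd j)) v hv.1 ?_
  have h : ⨆ p : ℤ × ℤ, ⨆ (_ : p ≠ (i, j)), M.comp (p.1 - p.2) p.2 ≤
      (⨆ j', ⨆ (_ : j' ≠ j), M.deg j').comap (M.act (A.e k (i - j))) := by
    refine iSup₂_le fun p hp w hw => ?_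
    rw [Submodule.mem_comap]
    by_cases hj : p.2 = j
    · rw [M.act_e_of_mem_of_ne _ hw]
      · exact zero_mem _
      · intro h
        exact hp (Prod.ext (by simp only; omega) hj)
    · exact Submodule.mem_iSup_of_mem p.2 (Submodule.mem_iSup_of_mem hj
        (M.act_e_mem_deg _ hw.1))
  have := h hv'
  rwa [Submodule.mem_comap, M.act_e_of_mem hv] at this

theorem isInternal_comp : DirectSum.IsInternal fun p : ℤ × ℤ => M.comp (p.1 - p.2) p.2 :=
  DirectSum.isInternal_submodule_of_iSupIndep_of_iSup_eq_top M.iSupIndep_comp M.iSup_comp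

variable {M N}

/-- Linear maps out of a graded module that agree on all components are equal. -/
theorem linearMap_ext {W : Type*} [AddCommGroup W] [Module k W] {f g : M.V →ₗ[k] W}
    (h : ∀ i j, ∀ v ∈ M.comp (i - j) j, f v = g v) : f = g := by
  refine LinearMap.ext fun v => ?_
  have hv : v ∈ ⨆ p : ℤ × ℤ, M.comp (p.1 - p.2) p.2 := by rw [M.iSup_comp]; trivial
  induction hv using Submodule.iSup_induction' with
  | mem p v hv => exact h _ _ v hv
  | zero => rw [map_zero, map_zero]
  | add v w _ _ h h' => rw [map_add, map_add, h, h']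

theorem hom_ext_comp {f g : M ⟶ N}
    (h : ∀ i j, ∀ v ∈ M.comp (i - j) j, f.toLin v = g.toLin v) : f = g :=
  hom_ext (linearMap_ext h)

/-- Linear maps on the components glue to a linear map. -/
theorem exists_linearMap {W : Type*} [AddCommGroup W] [Module k W]
    (φ : ∀ i j, M.comp (i - j) j →ₗ[k] W) :
    ∃ f : M.V →ₗ[k] W, ∀ i j (v : M.comp (i - j) j), f v = φ i j v := by
  let e := LinearEquiv.ofBijective
    (DirectSum.coeLinearMap fun p : ℤ × ℤ => M.comp (p.1 - p.2) p.2) M.isInternal_comp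
  refine ⟨DirectSum.toModule k (ℤ × ℤ) W (fun p => φ p.1 p.2) ∘ₗ e.symm.toLinearMap,
    fun i j v => ?_⟩
  have h : e (DirectSum.lof k (ℤ × ℤ) (fun p => M.comp (p.1 - p.2) p.2) (i, j) v) = v := by
    change DirectSum.coeLinearMap _ _ = _
    rw [DirectSum.coeLinearMap_lof]
  rw [LinearMap.comp_apply, LinearEquiv.coe_coe, ← h, e.symm_apply_apply,
    DirectSum.toModule_lof]

/-- A linear map that preserves the components and commutes with the arrows is a homomorphism
of graded modules. -/
theorem exists_hom_of_linearMap (f : M.V →ₗ[k] N.V)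
    (hf : ∀ i j, ∀ v ∈ M.comp (i - j) j, f v ∈ N.comp (i - j) j)
    (hr : ∀ i j, ∀ v ∈ M.comp (i - j) j,
      f (M.act (A.right k (i - j)) v) = N.act (A.right k (i - j)) (f v))
    (hl : ∀ i j, ∀ v ∈ M.comp (i - j) j,
      f (M.act (A.left k (i - j)) v) = N.act (A.left k (i - j)) (f v)) :
    ∃ g : M ⟶ N, g.toLin = f := by
  -- The elements of `A` whose action commutes with `f` form a subspace closed under products, so
  -- idempotents and arrows suffice. The idempotents lie in it because `f` preserves components.
  let S : Submodule k (A k) :=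
    { carrier := {x | ∀ v, f (M.act x v) = N.act x (f v)}
      add_mem' := fun {x y} hx hy v => by
        rw [map_add, map_add, LinearMap.add_apply, LinearMap.add_apply, map_add, hx v, hy v]
      zero_mem' := fun v => by simp
      smul_mem' := fun c x hx v => by
        rw [map_smul, map_smul, LinearMap.smul_apply, LinearMap.smul_apply, map_smul, hx v] }
  have hS : ∀ x, (∀ i j, ∀ v ∈ M.comp (i - j) j, f (M.act x v) = N.act x (f v)) → x ∈ S := by
    intro x hx v
    exact DFunLike.congr_fun
      (linearMap_ext (f := f ∘ₗ M.act x) (g := N.act x ∘ₗ f) hx) v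
  have htop : S = ⊤ := by
    refine A.eq_top_of_closed k S (fun r => hS _ fun i j v hv => ?_)
      (fun r => hS _ fun i j v hv => ?_) (fun r => hS _ fun i j v hv => ?_)
      (fun x hx y hy v => ?_)
    · by_cases h : i - j = r
      · subst h
        rw [M.act_e_of_mem hv, N.act_e_of_mem (hf _ _ _ hv)]
      · rw [M.act_e_of_mem_of_ne h hv, N.act_e_of_mem_of_ne h (hf _ _ _ hv), map_zero]
    · by_cases h : i - j = r
      · subst h
        exact hr i j v hv
      · rw [M.act_right_of_mem_of_ne h hv, N.act_right_of_mem_of_ne h (hf _ _ _ hv), map_zero]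
    · by_cases h : i - j = r
      · subst h
        exact hl i j v hv
      · rw [M.act_left_of_mem_of_ne h hv, N.act_left_of_mem_of_ne h (hf _ _ _ hv), map_zero]
    · rw [M.act_mul, N.act_mul, hy, hx]
  refine ⟨⟨f, fun x v => ?_, fun {j v} hv => ?_⟩, rfl⟩
  · have hx : x ∈ S := htop ▸ Submodule.mem_top
    exact hx v
  · have h : ⨆ r : ℤ, M.comp r j ≤ (N.deg j).comap f := by
      refine iSup_le fun r w hw => ?_
      obtain ⟨i, rfl⟩ : ∃ i, r = i - j := ⟨r + j, by ring⟩
      exact (hf i j w hw).1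
    exact h (M.deg_le_iSup_comp j hv)

end GrMod

/-! ### Rows of tricomplexes as graded modules over the zigzag algebra -/

/-- Anti-homomorphisms from paths to endomorphisms that satisfy the relations of the zigzag
algebra define actions of it. -/
theorem A.exists_lift {V : Type u} [AddCommGroup V] [Module k V]
    (ρ : PathSemigroup →ₙ* (Module.End k V)ᵐᵒᵖ) (h0 : ρ .zero = 0)
    (hrr : ∀ r, ρ (.path ((rightPath r).cons (Arrow.right (r + 1)))) = 0)
    (hll : ∀ r, ρ (.path ((leftPath r).cons (Arrow.left (r - 1)))) = 0)
    (hlr : ∀ r, ρ (.path ((leftPath r).cons (Arrow.right (r - 1)))) =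
      ρ (.path ((rightPath r).cons (Arrow.left (r + 1))))) :
    ∃ act : A k →ₗ[k] Module.End k V,
      (∀ (x y : A k) (v : V), act (x * y) v = act y (act x v)) ∧
      ∀ {a b : Vertex} (p : Quiver.Path a b), act (A.path k p) = (ρ (.path p)).unop := by
  let F : PreAlgebra k →ₙₐ[k] (Module.End k V)ᵐᵒᵖ := MonoidAlgebra.liftMagma k ρ
  have hF : ∀ s, F (MonoidAlgebra.single s 1) = ρ s := fun s => by
    simp [F, MonoidAlgebra.liftMagma_apply_apply]
  have hrel : ∀ y, IsRelator k y → F y = 0 := by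
    intro y hy
    cases hy with
    | zero_path => rw [hF, h0]
    | right_right r => exact (hF _).trans (hrr r)
    | left_left r => exact (hF _).trans (hll r)
    | loops r =>
      rw [map_sub, sub_eq_zero]
      exact (hF _).trans ((hlr r).trans (hF _).symm)
  have hker : ∀ x y, (relations k).ringCon x y → F x = F y := by
    intro x y h
    change RingConGen.Rel _ _ _ at h
    induction h with
    | of x y h =>
      obtain ⟨c, z, hz, h⟩ := h
      rw [← sub_eq_zero, ← map_sub, h, map_smul, hrel z hz, smul_zero]
    | refl x => rfl
    | symm _ ih => exact ih.symm
    | trans _ _ ih₁ ih₂ => exact ih₁.trans ih₂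
    | add _ _ ih₁ ih₂ => rw [map_add, map_add, ih₁, ih₂]
    | mul _ _ ih₁ ih₂ => rw [map_mul, map_mul, ih₁, ih₂]
  let G : A k → Module.End k V := fun x =>
    Quotient.liftOn' x (fun y => (F y).unop) (fun a b h => congrArg _ (hker a b h))
  have hG : ∀ y, G (A.proj k y) = (F y).unop := fun y => rfl
  refine ⟨⟨⟨G, ?_⟩, ?_⟩, ?_, ?_⟩
  · intro x y
    obtain ⟨x, rfl⟩ := A.proj_surjective k x
    obtain ⟨y, rfl⟩ := A.proj_surjective k y
    change G (A.proj k (x + y)) = _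
    rw [hG, hG, hG, map_add, MulOpposite.unop_add]
  · intro c x
    obtain ⟨x, rfl⟩ := A.proj_surjective k x
    change G (A.proj k (c • x)) = c • G (A.proj k x)
    rw [hG, hG, map_smul, MulOpposite.unop_smul]
  · intro x y v
    obtain ⟨x, rfl⟩ := A.proj_surjective k x
    obtain ⟨y, rfl⟩ := A.proj_surjective k y
    change G (A.proj k (x * y)) v = G (A.proj k y) (G (A.proj k x) v)
    rw [hG, hG, hG, map_mul, MulOpposite.unop_mul]
    rfl
  · intro a b p
    change G (A.proj k (ofPath k p)) = _
    rw [hG, ofPath, hF]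

namespace Tot

variable (W : Tricomplex k) (l : ℤ)

/-- The direct sum of the components of a row of a tricomplex. -/
abbrev Carrier : Type u := DirectSum (ℤ × ℤ) fun p => W.X p.1 p.2 l

/-- The inclusion of a component. -/
def incl (i j : ℤ) : W.X i j l →ₗ[k] Carrier W l :=
  DirectSum.lof k (ℤ × ℤ) (fun p => W.X p.1 p.2 l) (i, j)

/-- The projection to a component. -/
def proj (i j : ℤ) : Carrier W l →ₗ[k] W.X i j l :=
  DirectSum.component k (ℤ × ℤ) (fun p => W.X p.1 p.2 l) (i, j)

variable {W l}

theorem proj_incl (i j : ℤ) (x : W.X i j l) : proj W l i j (incl W l i j x) = x :=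
  DirectSum.component.lof_self k (M := fun p : ℤ × ℤ => W.X p.1 p.2 l) (i, j) x

theorem proj_incl_of_ne {i j i' j' : ℤ} (h : (i, j) ≠ (i', j')) (x : W.X i j l) :
    proj W l i' j' (incl W l i j x) = 0 :=
  (DirectSum.component.of k (M := fun p : ℤ × ℤ => W.X p.1 p.2 l) (i', j') (i, j) x).trans (dif_neg h)

theorem linearMap_ext {U : Type*} [AddCommGroup U] [Module k U] {f g : Carrier W l →ₗ[k] U}
    (h : ∀ i j x, f (incl W l i j x) = g (incl W l i j x)) : f = g :=
  DirectSum.linearMap_ext k fun p => LinearMap.ext fun x => h p.1 p.2 x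

variable (W l)

/-- The action of the arrows `(r|r+1)`. -/
def right : Module.End k (Carrier W l) :=
  DirectSum.toModule k _ _ fun p => incl W l (p.1 + 1) p.2 ∘ₗ W.d₁ p.1 p.2 l

/-- The action of the arrows `(r|r-1)`. -/
def left : Module.End k (Carrier W l) :=
  DirectSum.toModule k _ _ fun p =>
    (p.1 - p.2).negOnePow • (incl W l p.1 (p.2 + 1) ∘ₗ W.d₂ p.1 p.2 l)

/-- The projection onto the part at the vertex `r`. -/
def vert (r : ℤ) : Module.End k (Carrier W l) :=
  DirectSum.toModule k _ _ fun p => if p.1 - p.2 = r then incl W l p.1 p.2 else 0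

/-- The projection onto the part of degree `d`. -/
def degProj (d : ℤ) : Module.End k (Carrier W l) :=
  DirectSum.toModule k _ _ fun p => if p.2 = d then incl W l p.1 p.2 else 0

variable {W l}

@[simp] theorem right_incl (i j : ℤ) (x : W.X i j l) :
    right W l (incl W l i j x) = incl W l (i + 1) j (W.d₁ i j l x) :=
  DirectSum.toModule_lof k (M := fun p : ℤ × ℤ => W.X p.1 p.2 l) (i, j) x

@[simp] theorem left_incl (i j : ℤ) (x : W.X i j l) :
    left W l (incl W l i j x) = (i - j).negOnePow • incl W l i (j + 1) (W.d₂ i j l x) :=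
  DirectSum.toModule_lof k (M := fun p : ℤ × ℤ => W.X p.1 p.2 l) (i, j) x

theorem vert_incl (r i j : ℤ) (x : W.X i j l) :
    vert W l r (incl W l i j x) = if i - j = r then incl W l i j x else 0 := by
  refine (DirectSum.toModule_lof k (M := fun p : ℤ × ℤ => W.X p.1 p.2 l) (i, j) x).trans ?_
  change (if i - j = r then incl W l i j else 0) x = _
  split_ifs <;> rfl

theorem degProj_incl (d i j : ℤ) (x : W.X i j l) :
    degProj W l d (incl W l i j x) = if j = d then incl W l i j x else 0 := by
  refine (DirectSum.toModule_lof k (M := fun p : ℤ × ℤ => W.X p.1 p.2 l) (i, j) x).trans ?_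
  change (if j = d then incl W l i j else 0) x = _
  split_ifs <;> rfl

theorem right_right : right W l ∘ₗ right W l = 0 :=
  linearMap_ext fun i j x => by simp [W.d₁_d₁]

theorem left_left : left W l ∘ₗ left W l = 0 :=
  linearMap_ext fun i j x => by
    simp [W.d₂_d₂, Units.smul_def]

/-- `∂₁` changes the parity of `i - j`, so the sign built into `left` absorbs the anticommutation of
`∂₁` and `∂₂`. -/
theorem right_left : right W l ∘ₗ left W l = left W l ∘ₗ right W l :=
  linearMap_ext fun i j x => by
    have h : i + 1 - j = i - j + 1 := by ring
    have h' := eq_neg_of_add_eq_zero_left (W.d₁_d₂ i j l x)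
    simp [Units.smul_def, h, h', Int.negOnePow_succ]

theorem vert_vert (r : ℤ) : vert W l r ∘ₗ vert W l r = vert W l r :=
  linearMap_ext fun i j x => by
    by_cases h : i - j = r <;> simp [vert_incl, h]

theorem vert_vert_of_ne {r s : ℤ} (hrs : r ≠ s) : vert W l r ∘ₗ vert W l s = 0 :=
  linearMap_ext fun i j x => by
    by_cases h : i - j = s
    · simp [vert_incl, h, hrs.symm]
    · simp [vert_incl, h]

theorem degProj_degProj (r : ℤ) : degProj W l r ∘ₗ degProj W l r = degProj W l r :=
  linearMap_ext fun i j x => by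
    by_cases h : j = r <;> simp [degProj_incl, h]

theorem degProj_degProj_of_ne {r s : ℤ} (hrs : r ≠ s) : degProj W l r ∘ₗ degProj W l s = 0 :=
  linearMap_ext fun i j x => by
    by_cases h : j = s
    · simp [degProj_incl, h, hrs.symm]
    · simp [degProj_incl, h]

theorem right_vert (r : ℤ) : right W l ∘ₗ vert W l r = vert W l (r + 1) ∘ₗ right W l :=
  linearMap_ext fun i j x => by
    have h' : i + 1 - j = r + 1 ↔ i - j = r := by omega
    by_cases h : i - j = r <;> simp [vert_incl, h', h]

theorem left_vert (r : ℤ) : left W l ∘ₗ vert W l r = vert W l (r - 1) ∘ₗ left W l :=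
  linearMap_ext fun i j x => by
    have h' : i - (j + 1) = r - 1 ↔ i - j = r := by omega
    by_cases h : i - j = r <;> simp [vert_incl, h', h, Units.smul_def]

theorem vert_degProj (r d : ℤ) : vert W l r ∘ₗ degProj W l d = degProj W l d ∘ₗ vert W l r :=
  linearMap_ext fun i j x => by
    simp only [LinearMap.comp_apply, vert_incl, degProj_incl, apply_ite, map_zero]
    split_ifs <;> rfl

theorem right_degProj (d : ℤ) : right W l ∘ₗ degProj W l d = degProj W l d ∘ₗ right W l :=
  linearMap_ext fun i j x => by
    by_cases h' : j = d <;> simp [degProj_incl, h']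

theorem left_degProj (d : ℤ) : left W l ∘ₗ degProj W l d = degProj W l (d + 1) ∘ₗ left W l :=
  linearMap_ext fun i j x => by
    by_cases h' : j = d <;> simp [degProj_incl, h', Units.smul_def]

theorem incl_mem_range_vert (i j : ℤ) (x : W.X i j l) :
    incl W l i j x ∈ LinearMap.range (vert W l (i - j)) :=
  ⟨incl W l i j x, by simp [vert_incl]⟩

theorem incl_mem_range_degProj (i j : ℤ) (x : W.X i j l) :
    incl W l i j x ∈ LinearMap.range (degProj W l j) :=
  ⟨incl W l i j x, by simp [degProj_incl]⟩

/-- A subspace that contains all components is everything. -/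
theorem eq_top_of_incl_mem (S : Submodule k (Carrier W l))
    (h : ∀ i j x, incl W l i j x ∈ S) : S = ⊤ := by
  have h0 : S.mkQ = 0 := linearMap_ext fun i j x => by
    rw [Submodule.mkQ_apply, (Submodule.Quotient.mk_eq_zero S).2 (h i j x)]; rfl
  rw [← S.ker_mkQ, h0, LinearMap.ker_zero]

variable (W l) in
/-- The action of an arrow. -/
def arrow : ∀ {a b : ℤ}, Arrow a b → Module.End k (Carrier W l)
  | _, _, .right _ => right W l
  | _, _, .left _ => left W l

variable (W l) in
/-- The action of a path. -/
def path {a : Vertex} : ∀ {b : Vertex}, Quiver.Path a b → Module.End k (Carrier W l)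
  -- A path of length 0 acts as the projection to its vertex; hence a longer path acts as its arrows
  -- after the projection to its source.
  | _, .nil => vert W l a
  | _, .cons p e => arrow W l e ∘ₗ path p

theorem arrow_vert {a b : ℤ} (e : Arrow a b) :
    arrow W l e ∘ₗ vert W l a = vert W l b ∘ₗ arrow W l e := by
  cases e
  · exact right_vert a
  · exact left_vert a

theorem arrow_degProj {a b : ℤ} (e : Arrow a b) (d : ℤ) :
    arrow W l e ∘ₗ degProj W l d = degProj W l (d + e.degree) ∘ₗ arrow W l e := by
  cases e
  · rw [Arrow.degree, add_zero]; exact right_degProj d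
  · exact left_degProj d

theorem vert_path {a b : Vertex} (p : Quiver.Path a b) :
    vert W l b ∘ₗ path W l p = path W l p := by
  induction p with
  | nil => exact vert_vert a
  | cons p e ih =>
    change (vert W l _ ∘ₗ arrow W l e) ∘ₗ path W l p = arrow W l e ∘ₗ path W l p
    refine (congrArg (· ∘ₗ path W l p) (arrow_vert e).symm).trans ?_
    exact congrArg (arrow W l e ∘ₗ ·) ih

theorem path_vert {a b : Vertex} (p : Quiver.Path a b) :
    path W l p ∘ₗ vert W l a = path W l p := by
  induction p with
  | nil => exact vert_vert a
  | cons p e ih => rw [path, LinearMap.comp_assoc, ih]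

theorem path_comp {a b c : Vertex} (p : Quiver.Path a b) (q : Quiver.Path b c) :
    path W l (p.comp q) = path W l q ∘ₗ path W l p := by
  induction q with
  | nil => exact (vert_path p).symm
  | cons q e ih => rw [Quiver.Path.comp_cons, path, path, ih, LinearMap.comp_assoc]

theorem path_comp_of_ne {a b c d : Vertex} (p : Quiver.Path a b) (q : Quiver.Path c d)
    (h : b ≠ c) : path W l q ∘ₗ path W l p = 0 := by
  rw [← vert_path p, ← path_vert q, LinearMap.comp_assoc, ← LinearMap.comp_assoc (path W l p),
    vert_vert_of_ne (Ne.symm h), LinearMap.zero_comp, LinearMap.comp_zero]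

theorem path_degProj {a b : Vertex} (p : Quiver.Path a b) (d : ℤ) :
    path W l p ∘ₗ degProj W l d = degProj W l (d + pathDegree p) ∘ₗ path W l p := by
  induction p with
  | nil => rw [pathDegree, add_zero]; exact vert_degProj _ _
  | cons p e ih =>
    rw [pathDegree, ← add_assoc]
    refine (congrArg (arrow W l e ∘ₗ ·) ih).trans ?_
    exact congrArg (· ∘ₗ path W l p) (arrow_degProj e (d + pathDegree p))

variable (W l) in
/-- The action of the semigroup of paths. -/
def pathHom : PathSemigroup →ₙ* (Module.End k (Carrier W l))ᵐᵒᵖ where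
  toFun
    | .zero => 0
    | .path p => MulOpposite.op (path W l p)
  map_mul' := by
    rintro (_ | @⟨a, b, p⟩) (_ | @⟨c, d, q⟩)
    · rw [PathSemigroup.zero_mul', zero_mul]
    · rw [PathSemigroup.zero_mul', zero_mul]
    · rw [PathSemigroup.mul_zero', mul_zero]
    · by_cases h : b = c
      · subst h
        rw [PathSemigroup.path_mul_path]
        exact congrArg MulOpposite.op (path_comp p q)
      · rw [PathSemigroup.path_mul_path_of_ne p q h]
        exact congrArg MulOpposite.op (path_comp_of_ne p q h).symm

variable (W l)

theorem exists_act : ∃ act : A k →ₗ[k] Module.End k (Carrier W l),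
    (∀ (x y : A k) (v : Carrier W l), act (x * y) v = act y (act x v)) ∧
    ∀ {a b : Vertex} (p : Quiver.Path a b), act (A.path k p) = path W l p := by
  refine A.exists_lift (pathHom W l) rfl (fun r => congrArg MulOpposite.op ?_)
    (fun r => congrArg MulOpposite.op ?_) (fun r => congrArg MulOpposite.op ?_)
  · change right W l ∘ₗ (right W l ∘ₗ vert W l r) = 0
    rw [← LinearMap.comp_assoc, right_right, LinearMap.zero_comp]
  · change left W l ∘ₗ (left W l ∘ₗ vert W l r) = 0
    rw [← LinearMap.comp_assoc, left_left, LinearMap.zero_comp]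
  · change right W l ∘ₗ (left W l ∘ₗ vert W l r) = left W l ∘ₗ (right W l ∘ₗ vert W l r)
    rw [← LinearMap.comp_assoc, right_left, LinearMap.comp_assoc]

/-- The action of `A` on the direct sum of a row. -/
def act : A k →ₗ[k] Module.End k (Carrier W l) := (exists_act W l).choose

variable {W l}

theorem act_path {a b : Vertex} (p : Quiver.Path a b) : act W l (A.path k p) = path W l p :=
  (exists_act W l).choose_spec.2 p

theorem act_e (r : ℤ) : act W l (A.e k r) = vert W l r := act_path _

theorem act_right (r : ℤ) : act W l (A.right k r) = right W l ∘ₗ vert W l r := act_path _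

theorem act_left (r : ℤ) : act W l (A.left k r) = left W l ∘ₗ vert W l r := act_path _

theorem act_mem {d j : ℤ} {x : A k} {v : Carrier W l} (hx : x ∈ A.degree k d)
    (hv : v ∈ LinearMap.range (degProj W l j)) :
    act W l x v ∈ LinearMap.range (degProj W l (j + d)) := by
  induction hx using Submodule.span_induction with
  | mem x hx =>
    obtain ⟨a, b, p, rfl, rfl⟩ := hx
    obtain ⟨w, rfl⟩ := hv
    rw [act_path]
    exact ⟨path W l p w, (DFunLike.congr_fun (path_degProj p j) w).symm⟩
  | zero => rw [map_zero]; exact zero_mem _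
  | add x y _ _ hx hy => rw [map_add]; exact add_mem hx hy
  | smul c x _ hx => rw [map_smul]; exact Submodule.smul_mem _ c hx

end Tot

/-- The graded module of a row of a tricomplex. -/
@[reducible] def Tot (W : Tricomplex k) (l : ℤ) : GrMod k where
  V := ModuleCat.of k (Tot.Carrier W l)
  deg d := LinearMap.range (Tot.degProj W l d)
  isInternal := by
    refine isInternal_range_of_idempotents (Tot.degProj W l) Tot.degProj_degProj
      (fun i j h => Tot.degProj_degProj_of_ne h) (Tot.eq_top_of_incl_mem _ fun i j x => ?_)
    exact Submodule.mem_iSup_of_mem j (Tot.incl_mem_range_degProj i j x)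
  act := Tot.act W l
  act_mul := (Tot.exists_act W l).choose_spec.1
  act_mem := Tot.act_mem
  iSup_vertex := by
    refine Tot.eq_top_of_incl_mem _ fun i j x => ?_
    refine Submodule.mem_iSup_of_mem (i - j) ?_
    rw [Tot.act_e]
    exact Tot.incl_mem_range_vert i j x

/-! ### Epimorphisms and surjections -/

namespace Tricomplex

variable {X Y Z W : Tricomplex k}

/-- The cokernel of a morphism of tricomplexes. -/
def coker (e : Z ⟶ W) : Tricomplex k where
  X i j l := ModuleCat.of k (W.X i j l ⧸ LinearMap.range (e.f i j l))
  d₁ i j l := Submodule.mapQ _ _ (W.d₁ i j l) (by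
    rintro _ ⟨x, rfl⟩; exact ⟨Z.d₁ i j l x, e.comm₁ i j l x⟩)
  d₂ i j l := Submodule.mapQ _ _ (W.d₂ i j l) (by
    rintro _ ⟨x, rfl⟩; exact ⟨Z.d₂ i j l x, e.comm₂ i j l x⟩)
  d₃ i j l := Submodule.mapQ _ _ (W.d₃ i j l) (by
    rintro _ ⟨x, rfl⟩; exact ⟨Z.d₃ i j l x, e.comm₃ i j l x⟩)
  d₁_d₁ i j l x := by
    obtain ⟨x, rfl⟩ := Submodule.mkQ_surjective _ x
    exact congrArg (Submodule.mkQ _) (W.d₁_d₁ i j l x)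
  d₂_d₂ i j l x := by
    obtain ⟨x, rfl⟩ := Submodule.mkQ_surjective _ x
    exact congrArg (Submodule.mkQ _) (W.d₂_d₂ i j l x)
  d₃_d₃ i j l x := by
    obtain ⟨x, rfl⟩ := Submodule.mkQ_surjective _ x
    exact congrArg (Submodule.mkQ _) (W.d₃_d₃ i j l x)
  d₁_d₂ i j l x := by
    obtain ⟨x, rfl⟩ := Submodule.mkQ_surjective _ x
    exact congrArg (Submodule.mkQ _) (W.d₁_d₂ i j l x)
  d₁_d₃ i j l x := by
    obtain ⟨x, rfl⟩ := Submodule.mkQ_surjective _ x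
    exact congrArg (Submodule.mkQ _) (W.d₁_d₃ i j l x)
  d₂_d₃ i j l x := by
    obtain ⟨x, rfl⟩ := Submodule.mkQ_surjective _ x
    exact congrArg (Submodule.mkQ _) (W.d₂_d₃ i j l x)

/-- The projection to the cokernel and the zero map agree after `e`, so the cokernel is zero. -/
theorem surjective_of_epi (e : Z ⟶ W) [Epi e] (i j l : ℤ) :
    Function.Surjective (e.f i j l) := by
  let q : W ⟶ coker e := ⟨fun i j l => Submodule.mkQ _, fun _ _ _ _ => rfl,
    fun _ _ _ _ => rfl, fun _ _ _ _ => rfl⟩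
  have h : q = 0 := by
    rw [← cancel_epi e]
    ext i j l x
    exact (Submodule.Quotient.mk_eq_zero _).2 ⟨x, rfl⟩
  intro x
  have hx : q.f i j l x = 0 := by rw [h]; rfl
  exact (Submodule.Quotient.mk_eq_zero _).1 hx

theorem epi_of_surjective (e : Z ⟶ W) (h : ∀ i j l, Function.Surjective (e.f i j l)) :
    Epi e where
  left_cancellation a b hab := by
    ext i j l x
    obtain ⟨y, rfl⟩ := h i j l x
    exact DFunLike.congr_fun (congrFun (congrFun (congrFun (congrArg Hom.f hab) i) j) l) y

end Tricomplex

theorem GrMod.epi_of_surjective {M N : GrMod k} (e : M ⟶ N)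
    (h : Function.Surjective e.toLin) : Epi e where
  left_cancellation a b hab := by
    ext x
    obtain ⟨y, rfl⟩ := h x
    exact DFunLike.congr_fun (congrArg GrMod.Hom.toLin hab) y

/-! ### Lifting maps from projective modules to rows of tricomplexes -/

namespace Tot

variable {Z W : Tricomplex k} {l : ℤ}

/-- The vertex `i - j` and the degree `j` determine `(i, j)`, so the two projections together cut
out one summand. -/
theorem vert_degProj_eq (i j : ℤ) (v : Carrier W l) :
    vert W l (i - j) (degProj W l j v) = incl W l i j (proj W l i j v) := by
  refine DFunLike.congr_fun (f := vert W l (i - j) ∘ₗ degProj W l j)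
    (g := incl W l i j ∘ₗ proj W l i j) (linearMap_ext fun i' j' x => ?_) v
  by_cases h : (i', j') = (i, j)
  · obtain ⟨rfl, rfl⟩ := Prod.ext_iff.1 h
    simp [degProj_incl, vert_incl, proj_incl]
  · rw [LinearMap.comp_apply, LinearMap.comp_apply, proj_incl_of_ne h, map_zero, degProj_incl]
    split_ifs with hj
    · rw [vert_incl, if_neg]
      intro hi
      exact h (Prod.ext (by simp only; omega) hj)
    · rw [map_zero]

theorem eq_incl_of_mem_comp {i j : ℤ} {v : Carrier W l} (hv : v ∈ (Tot W l).comp (i - j) j) :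
    v = incl W l i j (proj W l i j v) := by
  have h₁ : vert W l (i - j) v = v := by
    rw [← act_e]; exact (Tot W l).act_e_of_mem hv
  have h₂ : degProj W l j v = v := by
    obtain ⟨⟨w, rfl⟩, -⟩ := hv
    exact DFunLike.congr_fun (degProj_degProj j) w
  rw [← vert_degProj_eq, h₂, h₁]

theorem incl_mem_comp (i j : ℤ) (x : W.X i j l) :
    incl W l i j x ∈ (Tot W l).comp (i - j) j := by
  refine ⟨incl_mem_range_degProj i j x, ?_⟩
  change _ ∈ LinearMap.range (act W l (A.e k (i - j)))
  rw [act_e]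
  exact incl_mem_range_vert i j x

theorem act_right_incl (i j : ℤ) (x : W.X i j l) :
    (Tot W l).act (A.right k (i - j)) (incl W l i j x) =
      incl W l (i + 1) j (W.d₁ i j l x) := by
  change act W l _ _ = _
  rw [act_right, LinearMap.comp_apply, vert_incl, if_pos rfl, right_incl]

theorem act_left_incl (i j : ℤ) (x : W.X i j l) :
    (Tot W l).act (A.left k (i - j)) (incl W l i j x) =
      (i - j).negOnePow • incl W l i (j + 1) (W.d₂ i j l x) := by
  change act W l _ _ = _
  rw [act_left, LinearMap.comp_apply, vert_incl, if_pos rfl, left_incl]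

/-- Holds for every `v`, not only for `v` in a component: among the summands at the vertex `i - j`,
only `(i, j)` is sent by `∂₁` to `(i + 1, j)`. -/
theorem proj_act_right (i j : ℤ) (v : Carrier W l) :
    proj W l (i + 1) j ((Tot W l).act (A.right k (i - j)) v) =
      W.d₁ i j l (proj W l i j v) := by
  change proj W l (i + 1) j (act W l _ v) = _
  rw [act_right]
  refine DFunLike.congr_fun (f := proj W l (i + 1) j ∘ₗ right W l ∘ₗ vert W l (i - j))
    (g := W.d₁ i j l ∘ₗ proj W l i j) (linearMap_ext fun i' j' x => ?_) v
  by_cases h : (i', j') = (i, j)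
  · obtain ⟨rfl, rfl⟩ := Prod.ext_iff.1 h
    simp [vert_incl, proj_incl]
  · simp only [LinearMap.comp_apply, proj_incl_of_ne h, map_zero, vert_incl]
    split_ifs with hj
    · rw [right_incl, proj_incl_of_ne]
      intro h'
      simp only [Prod.mk.injEq] at h h'
      omega
    · rw [map_zero, map_zero]

theorem proj_act_left (i j : ℤ) (v : Carrier W l) :
    proj W l i (j + 1) ((Tot W l).act (A.left k (i - j)) v) =
      (i - j).negOnePow • W.d₂ i j l (proj W l i j v) := by
  change proj W l i (j + 1) (act W l _ v) = _
  rw [act_left]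
  refine DFunLike.congr_fun (f := proj W l i (j + 1) ∘ₗ left W l ∘ₗ vert W l (i - j))
    (g := (i - j).negOnePow • (W.d₂ i j l ∘ₗ proj W l i j))
    (linearMap_ext fun i' j' x => ?_) v
  by_cases h : (i', j') = (i, j)
  · obtain ⟨rfl, rfl⟩ := Prod.ext_iff.1 h
    simp [vert_incl, proj_incl, Units.smul_def]
  · simp only [LinearMap.comp_apply, LinearMap.smul_apply, proj_incl_of_ne h, map_zero,
      vert_incl, smul_zero]
    split_ifs with hj
    · rw [left_incl, Units.smul_def, map_zsmul, proj_incl_of_ne, smul_zero]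
      intro h'
      simp only [Prod.mk.injEq] at h h'
      omega
    · rw [map_zero, map_zero]

/-- Functoriality of `Tot`: `A`-linearity need only be checked on components, where it is
compatibility of `e` with `∂₁` and `∂₂`. -/
theorem exists_map (e : Z ⟶ W) :
    ∃ g : Tot Z l ⟶ Tot W l, ∀ i j x, g.toLin (incl Z l i j x) =
      incl W l i j (e.f i j l x) := by
  let f : Carrier Z l →ₗ[k] Carrier W l :=
    DirectSum.toModule k _ _ fun p => incl W l p.1 p.2 ∘ₗ e.f p.1 p.2 l
  have hf : ∀ i j x, f (incl Z l i j x) = incl W l i j (e.f i j l x) := fun i j x =>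
    DirectSum.toModule_lof k (M := fun p : ℤ × ℤ => Z.X p.1 p.2 l) (i, j) x
  obtain ⟨g, hg⟩ := GrMod.exists_hom_of_linearMap (M := Tot Z l) (N := Tot W l) f
    (fun i j v hv => by
      rw [eq_incl_of_mem_comp hv, hf]
      exact incl_mem_comp _ _ _)
    (fun i j v hv => by
      rw [eq_incl_of_mem_comp hv, hf, act_right_incl, act_right_incl, hf, e.comm₁])
    (fun i j v hv => by
      rw [eq_incl_of_mem_comp hv, hf, act_left_incl, act_left_incl, Units.smul_def,
        Units.smul_def, map_zsmul, hf, e.comm₂])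
  exact ⟨g, fun i j x => by rw [hg]; exact hf i j x⟩

end Tot

/-- Maps from the components of a projective module to a row of a tricomplex lift along
epimorphisms of tricomplexes. -/
theorem exists_lift_row (M : GrMod k) [Projective M] {Z W : Tricomplex k} (e : Z ⟶ W) [Epi e]
    (l : ℤ) (γ : ∀ i j, M.comp (i - j) j →ₗ[k] W.X i j l)
    (hr : ∀ i j (v : M.comp (i - j) j), γ (i + 1) j ⟨M.act (A.right k (i - j)) v,
      M.act_right_mem (by ring) v.2⟩ = W.d₁ i j l (γ i j v))
    (hl : ∀ i j (v : M.comp (i - j) j), γ i (j + 1) ⟨M.act (A.left k (i - j)) v,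
      M.act_left_mem (by ring) v.2⟩ = (i - j).negOnePow • W.d₂ i j l (γ i j v)) :
    ∃ δ : ∀ i j, M.comp (i - j) j →ₗ[k] Z.X i j l,
      (∀ i j (v : M.comp (i - j) j), δ (i + 1) j ⟨M.act (A.right k (i - j)) v,
        M.act_right_mem (by ring) v.2⟩ = Z.d₁ i j l (δ i j v)) ∧
      (∀ i j (v : M.comp (i - j) j), δ i (j + 1) ⟨M.act (A.left k (i - j)) v,
        M.act_left_mem (by ring) v.2⟩ = (i - j).negOnePow • Z.d₂ i j l (δ i j v)) ∧
      ∀ i j v, e.f i j l (δ i j v) = γ i j v := by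
  -- Assemble `γ` into a homomorphism from `M` to `Tot W l`, lift it along the epimorphism `Tot Z l
  -- ⟶ Tot W l`, and read off `δ` as the components of the lift.
  obtain ⟨f, hf⟩ := GrMod.exists_linearMap (M := M)
    (fun i j => Tot.incl W l i j ∘ₗ γ i j)
  obtain ⟨g, rfl⟩ := GrMod.exists_hom_of_linearMap (M := M) (N := Tot W l) f
    (fun i j v hv => by
      rw [hf i j ⟨v, hv⟩]
      exact Tot.incl_mem_comp _ _ _)
    (fun i j v hv => by
      rw [hf i j ⟨v, hv⟩, hf (i + 1) j ⟨_, M.act_right_mem (by ring) hv⟩]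
      refine Eq.trans ?_ (Tot.act_right_incl i j _).symm
      exact congrArg (Tot.incl W l (i + 1) j) (hr i j ⟨v, hv⟩))
    (fun i j v hv => by
      rw [hf i j ⟨v, hv⟩, hf i (j + 1) ⟨_, M.act_left_mem (by ring) hv⟩]
      refine Eq.trans ?_ (Tot.act_left_incl i j _).symm
      refine (congrArg (Tot.incl W l i (j + 1)) (hl i j ⟨v, hv⟩)).trans ?_
      rw [Units.smul_def, map_zsmul, Units.smul_def])
  obtain ⟨t, ht⟩ := Tot.exists_map (l := l) e
  have hepi : Epi t := GrMod.epi_of_surjective t (LinearMap.range_eq_top.1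
    (Tot.eq_top_of_incl_mem _ fun i j x => by
      obtain ⟨y, rfl⟩ := Tricomplex.surjective_of_epi e i j l x
      exact ⟨_, ht i j y⟩))
  let h : M ⟶ Tot Z l := Projective.factorThru g t
  have hproj : ∀ i j (w : Tot.Carrier Z l), e.f i j l (Tot.proj Z l i j w) =
      Tot.proj W l i j (t.toLin w) := by
    intro i j w
    refine DFunLike.congr_fun (f := e.f i j l ∘ₗ Tot.proj Z l i j)
      (g := Tot.proj W l i j ∘ₗ t.toLin) (Tot.linearMap_ext fun i' j' x => ?_) w
    rw [LinearMap.comp_apply, LinearMap.comp_apply, ht]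
    by_cases hp : (i', j') = (i, j)
    · obtain ⟨rfl, rfl⟩ := Prod.ext_iff.1 hp
      rw [Tot.proj_incl, Tot.proj_incl]
    · rw [Tot.proj_incl_of_ne hp, Tot.proj_incl_of_ne hp, map_zero]
  refine ⟨fun i j => Tot.proj Z l i j ∘ₗ h.toLin ∘ₗ (M.comp (i - j) j).subtype,
    fun i j v => ?_, fun i j v => ?_, fun i j v => ?_⟩
  · exact (congrArg (Tot.proj Z l (i + 1) j) (h.map_act _ v)).trans (Tot.proj_act_right i j _)
  · exact (congrArg (Tot.proj Z l i (j + 1)) (h.map_act _ v)).trans (Tot.proj_act_left i j _)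
  · refine (hproj i j (h.toLin v)).trans ?_
    have hh : t.toLin (h.toLin v) = g.toLin v :=
      DFunLike.congr_fun (congrArg GrMod.Hom.toLin (Projective.factorThru_comp g t)) v.1
    rw [hh, hf]
    exact Tot.proj_incl i j _

/-! ### Null morphisms, induced and coinduced tricomplexes -/

/-- A family indexed by the successors of all integers is a family indexed by all integers. -/
theorem exists_eq_succ {P : ℤ → Sort*} (f : ∀ l, P (l + 1)) :
    ∃ g : ∀ l, P l, ∀ l, g (l + 1) = f l := by
  refine ⟨fun l => (sub_add_cancel l 1) ▸ f (l - 1), fun l => ?_⟩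
  have h : ∀ m (hm : m = l) (h' : m + 1 = l + 1), (h' ▸ f m : P (l + 1)) = f l := by
    rintro m rfl _
    rfl
  exact h _ (add_sub_cancel_right l 1) _

namespace Tricomplex

variable {X Y Z W : Tricomplex k}

/-- The tricomplex coinduced from the rows of a tricomplex. -/
def coind (X : Tricomplex k) : Tricomplex k where
  X i j l := ModuleCat.of k (X.X i j (l + 1) × X.X i j l)
  -- Think of `(a, b)` as `a + ∂₃ b` with `a`, `b` free generators; the sign on the first factor
  -- makes `∂₁` and `∂₂` anticommute with `∂₃`.
  d₁ i j l := (-X.d₁ i j (l + 1)).prodMap (X.d₁ i j l)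
  d₂ i j l := (-X.d₂ i j (l + 1)).prodMap (X.d₂ i j l)
  d₃ i j l := LinearMap.inr k _ _ ∘ₗ LinearMap.fst k _ _
  d₁_d₁ i j l x := Prod.ext (by simp [X.d₁_d₁]) (by simp [X.d₁_d₁])
  d₂_d₂ i j l x := Prod.ext (by simp [X.d₂_d₂]) (by simp [X.d₂_d₂])
  d₃_d₃ i j l x := Prod.ext (by simp) (by simp)
  d₁_d₂ i j l x := Prod.ext (by simp [X.d₁_d₂]) (by simp [X.d₁_d₂])
  d₁_d₃ i j l x := Prod.ext (by simp) (by simp)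
  d₂_d₃ i j l x := Prod.ext (by simp) (by simp)

/-- The unit of coinduction. -/
def toCoind (X : Tricomplex k) : X ⟶ coind X where
  f i j l := (X.d₃ i j l).prod LinearMap.id
  comm₁ i j l x := Prod.ext
    (eq_neg_of_add_eq_zero_right (X.d₁_d₃ i j l x)) rfl
  comm₂ i j l x := Prod.ext
    (eq_neg_of_add_eq_zero_right (X.d₂_d₃ i j l x)) rfl
  comm₃ i j l x := Prod.ext (X.d₃_d₃ i j l x) rfl

/-- Families of maps of degree `-1` that anticommute with `∂₁` and `∂₂` define morphisms
from the coinduced tricomplex. -/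
theorem exists_hom_coind (γ : ∀ i j l, X.X i j (l + 1) →ₗ[k] Z.X i j l)
    (h₁ : ∀ i j l x, γ (i + 1) j l (X.d₁ i j (l + 1) x) = -Z.d₁ i j l (γ i j l x))
    (h₂ : ∀ i j l x, γ i (j + 1) l (X.d₂ i j (l + 1) x) = -Z.d₂ i j l (γ i j l x)) :
    ∃ g : coind X ⟶ Z, ∀ i j l a b,
      g.f i j (l + 1) (a, b) = γ i j (l + 1) a + Z.d₃ i j l (γ i j l b) := by
  -- On the second factor the map must be `∂₃ ∘ γ`, which arrives in an index of the form `l + 1`;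
  -- `ρ` reindexes it to all integers.
  obtain ⟨ρ, hρ⟩ := exists_eq_succ (P := fun l => ∀ i j, X.X i j l →ₗ[k] Z.X i j l)
    (fun l i j => Z.d₃ i j l ∘ₗ γ i j l)
  have hρ' : ∀ i j l x, ρ (l + 1) i j x = Z.d₃ i j l (γ i j l x) := fun i j l x => by
    rw [hρ]; rfl
  have hl : ∀ l : ℤ, ∃ m, l = m + 1 := fun l => ⟨l - 1, by ring⟩
  refine ⟨⟨fun i j l => (γ i j l).coprod (ρ l i j), ?_, ?_, ?_⟩, ?_⟩
  · rintro i j l ⟨a, b⟩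
    obtain ⟨m, rfl⟩ := hl l
    change γ (i + 1) j (m + 1) (-X.d₁ i j _ a) + ρ (m + 1) (i + 1) j (X.d₁ i j _ b) =
      Z.d₁ i j _ (γ i j _ a + ρ (m + 1) i j b)
    rw [hρ', hρ', map_neg, h₁, h₁, map_neg, map_add, neg_neg]
    congr 1
    exact (eq_neg_of_add_eq_zero_left (Z.d₁_d₃ i j m (γ i j m b))).symm
  · rintro i j l ⟨a, b⟩
    obtain ⟨m, rfl⟩ := hl l
    change γ i (j + 1) (m + 1) (-X.d₂ i j _ a) + ρ (m + 1) i (j + 1) (X.d₂ i j _ b) =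
      Z.d₂ i j _ (γ i j _ a + ρ (m + 1) i j b)
    rw [hρ', hρ', map_neg, h₂, h₂, map_neg, map_add, neg_neg]
    congr 1
    exact (eq_neg_of_add_eq_zero_left (Z.d₂_d₃ i j m (γ i j m b))).symm
  · rintro i j l ⟨a, b⟩
    obtain ⟨m, rfl⟩ := hl l
    change γ i j (m + 1 + 1) 0 + ρ (m + 1 + 1) i j a =
      Z.d₃ i j _ (γ i j _ a + ρ (m + 1) i j b)
    rw [hρ', hρ', map_zero, zero_add, map_add, Z.d₃_d₃, add_zero]
  · intro i j l a b
    rw [← hρ']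
    rfl

/-- A morphism is null if it is null-homotopic in the direction of `∂₃`. -/
def Null (F : X ⟶ Y) : Prop :=
  ∃ v : ∀ i j l, X.X i j (l + 1) →ₗ[k] Y.X i j l,
    (∀ i j l x, v (i + 1) j l (X.d₁ i j (l + 1) x) = -Y.d₁ i j l (v i j l x)) ∧
    (∀ i j l x, v i (j + 1) l (X.d₂ i j (l + 1) x) = -Y.d₂ i j l (v i j l x)) ∧
    ∀ i j l x, F.f i j (l + 1) x = v i j (l + 1) (X.d₃ i j (l + 1) x) +
      Y.d₃ i j l (v i j l x)

theorem Null.zero : Null (0 : X ⟶ Y) :=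
  ⟨fun _ _ _ => 0, by simp, by simp, by simp⟩

theorem Null.add {F G : X ⟶ Y} (hF : Null F) (hG : Null G) : Null (F + G) := by
  obtain ⟨v, h₁, h₂, h₃⟩ := hF
  obtain ⟨w, h₁', h₂', h₃'⟩ := hG
  refine ⟨fun i j l => v i j l + w i j l, fun i j l x => ?_, fun i j l x => ?_,
    fun i j l x => ?_⟩
  · simp only [LinearMap.add_apply, h₁, h₁', map_add, neg_add]
  · simp only [LinearMap.add_apply, h₂, h₂', map_add, neg_add]
  · simp only [LinearMap.add_apply, add_f, h₃, h₃', map_add]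
    abel

theorem Null.neg {F : X ⟶ Y} (hF : Null F) : Null (-F) := by
  obtain ⟨v, h₁, h₂, h₃⟩ := hF
  refine ⟨fun i j l => -v i j l, fun i j l x => ?_, fun i j l x => ?_, fun i j l x => ?_⟩
  · simp only [LinearMap.neg_apply, h₁, map_neg]
  · simp only [LinearMap.neg_apply, h₂, map_neg]
  · simp only [LinearMap.neg_apply, neg_f, h₃, map_neg, neg_add]

/-- A null morphism factors through the coinduced tricomplex. -/
theorem Null.exists_factor {F : X ⟶ Y} (hF : Null F) :
    ∃ b : coind X ⟶ Y, F = toCoind X ≫ b := by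
  obtain ⟨v, h₁, h₂, h₃⟩ := hF
  obtain ⟨b, hb⟩ := exists_hom_coind v h₁ h₂
  refine ⟨b, ?_⟩
  ext i j l x
  obtain ⟨m, rfl⟩ : ∃ m, l = m + 1 := ⟨l - 1, by ring⟩
  -- The homotopy formula is the value of `b` at `(∂₃ x, x)`, the image of `x` in `coind X`.
  exact (h₃ i j m x).trans (hb i j m _ _).symm

/-- The identification of components with equal indices. -/
def cast (X : Tricomplex k) (i j : ℤ) {l m : ℤ} (h : l = m) : X.X i j l →ₗ[k] X.X i j m :=
  h ▸ LinearMap.id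

theorem cast_d₁ (i j : ℤ) {l m : ℤ} (h : l = m) (x : X.X i j l) :
    X.cast (i + 1) j h (X.d₁ i j l x) = X.d₁ i j m (X.cast i j h x) := by
  subst h; rfl

theorem cast_d₂ (i j : ℤ) {l m : ℤ} (h : l = m) (x : X.X i j l) :
    X.cast i (j + 1) h (X.d₂ i j l x) = X.d₂ i j m (X.cast i j h x) := by
  subst h; rfl

theorem cast_d₃ (i j : ℤ) {l m : ℤ} (h : l = m) (h' : l + 1 = m + 1) (x : X.X i j l) :
    X.cast i j h' (X.d₃ i j l x) = X.d₃ i j m (X.cast i j h x) := by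
  subst h; rfl

theorem cast_cast (i j : ℤ) {l m n : ℤ} (h : l = m) (h' : m = n) (x : X.X i j l) :
    X.cast i j h' (X.cast i j h x) = X.cast i j (h.trans h') x := by
  subst h; subst h'; rfl

theorem cast_rfl (i j l : ℤ) (h : l = l) (x : X.X i j l) : X.cast i j h x = x := rfl

/-- The contractible tricomplex induced from the rows of a tricomplex. -/
def ind (Y : Tricomplex k) : Tricomplex k where
  X i j l := ModuleCat.of k (Y.X i j l × Y.X i j (l - 1))
  d₁ i j l := (Y.d₁ i j l).prodMap (-Y.d₁ i j (l - 1))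
  d₂ i j l := (Y.d₂ i j l).prodMap (-Y.d₂ i j (l - 1))
  d₃ i j l := LinearMap.inr k _ _ ∘ₗ Y.cast i j (add_sub_cancel_right l 1).symm ∘ₗ
    LinearMap.fst k _ _
  d₁_d₁ i j l x := Prod.ext (by simp [Y.d₁_d₁]) (by simp [Y.d₁_d₁])
  d₂_d₂ i j l x := Prod.ext (by simp [Y.d₂_d₂]) (by simp [Y.d₂_d₂])
  d₃_d₃ i j l x := Prod.ext (by simp) (by simp)
  d₁_d₂ i j l x := Prod.ext (by simp [Y.d₁_d₂]) (by simp [Y.d₁_d₂])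
  d₁_d₃ i j l x := Prod.ext (by simp) (by simp [cast_d₁])
  d₂_d₃ i j l x := Prod.ext (by simp) (by simp [cast_d₂])

/-- The counit of induction. -/
def fromInd (Y : Tricomplex k) : ind Y ⟶ Y where
  f i j l := LinearMap.coprod LinearMap.id (Y.cast i j (sub_add_cancel l 1) ∘ₗ Y.d₃ i j (l - 1))
  comm₁ := by
    rintro i j l ⟨a, b⟩
    change Y.d₁ i j l a + Y.cast (i + 1) j _ (Y.d₃ (i + 1) j (l - 1) (-Y.d₁ i j (l - 1) b)) =
      Y.d₁ i j l (a + Y.cast i j _ (Y.d₃ i j (l - 1) b))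
    rw [map_add, ← cast_d₁, map_neg, ← eq_neg_of_add_eq_zero_left (Y.d₁_d₃ i j (l - 1) b)]
  comm₂ := by
    rintro i j l ⟨a, b⟩
    change Y.d₂ i j l a + Y.cast i (j + 1) _ (Y.d₃ i (j + 1) (l - 1) (-Y.d₂ i j (l - 1) b)) =
      Y.d₂ i j l (a + Y.cast i j _ (Y.d₃ i j (l - 1) b))
    rw [map_add, ← cast_d₂, map_neg, ← eq_neg_of_add_eq_zero_left (Y.d₂_d₃ i j (l - 1) b)]
  comm₃ := by
    rintro i j l ⟨a, b⟩
    change (0 : Y.X i j (l + 1)) + Y.cast i j _ (Y.d₃ i j (l + 1 - 1) (Y.cast i j _ a)) =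
      Y.d₃ i j l (a + Y.cast i j _ (Y.d₃ i j (l - 1) b))
    rw [zero_add, map_add, cast_d₃ i j (add_sub_cancel_right l 1), cast_cast, cast_rfl,
      ← cast_d₃ i j (sub_add_cancel l 1) (by ring), Y.d₃_d₃, map_zero, add_zero]

instance epi_fromInd (Y : Tricomplex k) : Epi (fromInd Y) :=
  epi_of_surjective _ fun i j l y => ⟨(y, 0), by
    change y + Y.cast i j _ (Y.d₃ i j (l - 1) 0) = y
    rw [map_zero, map_zero, add_zero]⟩

/-- A morphism through the induced tricomplex is null. -/
theorem Null.of_fromInd (a : X ⟶ ind Y) : Null (a ≫ fromInd Y) := by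
  -- The contraction is the second coordinate `a₂` of `a`. Compatibility with `∂₃` gives `a₁ x = a₂
  -- (∂₃ x)`, so `a₁ x + ∂₃ (a₂ x)` is the homotopy formula.
  refine ⟨fun i j l => Y.cast i j (add_sub_cancel_right l 1) ∘ₗ LinearMap.snd k _ _ ∘ₗ
    a.f i j (l + 1), fun i j l x => ?_, fun i j l x => ?_, fun i j l x => ?_⟩
  · have h := congrArg Prod.snd (a.comm₁ i j (l + 1) x)
    change (a.f (i + 1) j (l + 1) (X.d₁ i j (l + 1) x)).2 = -Y.d₁ i j _ (a.f i j (l + 1) x).2 at h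
    change Y.cast (i + 1) j _ (a.f (i + 1) j (l + 1) (X.d₁ i j (l + 1) x)).2 =
      -Y.d₁ i j l (Y.cast i j _ (a.f i j (l + 1) x).2)
    rw [h, map_neg, cast_d₁]
  · have h := congrArg Prod.snd (a.comm₂ i j (l + 1) x)
    change (a.f i (j + 1) (l + 1) (X.d₂ i j (l + 1) x)).2 = -Y.d₂ i j _ (a.f i j (l + 1) x).2 at h
    change Y.cast i (j + 1) _ (a.f i (j + 1) (l + 1) (X.d₂ i j (l + 1) x)).2 =
      -Y.d₂ i j l (Y.cast i j _ (a.f i j (l + 1) x).2)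
    rw [h, map_neg, cast_d₂]
  · have h := congrArg Prod.snd (a.comm₃ i j (l + 1) x)
    change (a.f i j (l + 1 + 1) (X.d₃ i j (l + 1) x)).2 = Y.cast i j _ (a.f i j (l + 1) x).1 at h
    change (a.f i j (l + 1) x).1 + Y.cast i j _ (Y.d₃ i j (l + 1 - 1) (a.f i j (l + 1) x).2) =
      Y.cast i j _ (a.f i j (l + 1 + 1) (X.d₃ i j (l + 1) x)).2 +
        Y.d₃ i j l (Y.cast i j _ (a.f i j (l + 1) x).2)
    rw [h, cast_cast, cast_rfl, cast_d₃]

/-- Projectivity lifts `b` along the epimorphism `ind Y ⟶ Y`. -/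
theorem Null.of_projective {P : Tricomplex k} [Projective P] (a : X ⟶ P) (b : P ⟶ Y) :
    Null (a ≫ b) := by
  rw [← Projective.factorThru_comp b (fromInd Y), ← Category.assoc]
  exact Null.of_fromInd _

/-- Morphisms through projectives are stable under composition on both sides, and null morphisms are
closed under sums and negatives; this covers the generated equivalence relation. -/
theorem null_of_eqvGen {F G : X ⟶ Y}
    (h : Relation.EqvGen (HomRel.CompClosure (stableRel (k := k)) (X := X) (Y := Y)) F G) : Null (F - G) := by
  induction h with
  | rel F G h =>
    obtain ⟨_, _, a, F', G', b, ⟨P, hP, c, d, hcd⟩⟩ := h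
    have : a ≫ F' ≫ b - a ≫ G' ≫ b = (a ≫ c) ≫ (d ≫ b) := by
      rw [← Preadditive.comp_sub, ← Preadditive.sub_comp, hcd]
      simp only [Category.assoc]
    rw [this]
    exact Null.of_projective _ _
  | refl F => rw [sub_self]; exact Null.zero
  | symm F G _ ih => rw [← neg_sub]; exact ih.neg
  | trans F G H _ _ ih ih' => rw [← sub_add_sub_cancel]; exact ih.add ih'

/-- Morphisms that become equal in the stable category differ by a null morphism. -/
theorem null_of_stable_eq {F G : X ⟶ Y}
    (h : (SM3.quotient k).map F = (SM3.quotient k).map G) : Null (F - G) := by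
  refine null_of_eqvGen (Quot.eqvGen_exact h)

/-- A tricomplex whose rows have the lifting property of projective modules. -/
def RowLifting (X : Tricomplex k) : Prop :=
  ∀ (Z W : Tricomplex k) (e : Z ⟶ W) [Epi e] (l m : ℤ)
    (γ : ∀ i j, X.X i j l →ₗ[k] W.X i j m)
    (_ : ∀ i j x, γ (i + 1) j (X.d₁ i j l x) = -W.d₁ i j m (γ i j x))
    (_ : ∀ i j x, γ i (j + 1) (X.d₂ i j l x) = -W.d₂ i j m (γ i j x)),
    ∃ δ : ∀ i j, X.X i j l →ₗ[k] Z.X i j m,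
      (∀ i j x, δ (i + 1) j (X.d₁ i j l x) = -Z.d₁ i j m (δ i j x)) ∧
      (∀ i j x, δ i (j + 1) (X.d₂ i j l x) = -Z.d₂ i j m (δ i j x)) ∧
      ∀ i j x, e.f i j m (δ i j x) = γ i j x

theorem RowLifting.projective_coind (hX : RowLifting X) : Projective (coind X) where
  factors {Z W} g e he := by
    -- A morphism out of `coind X` is determined by its restriction to the free generators `(a, 0)`,
    -- so only that restriction has to be lifted.
    let γ : ∀ l i j, X.X i j (l + 1) →ₗ[k] W.X i j l := fun l i j =>
      g.f i j l ∘ₗ LinearMap.inl k (X.X i j (l + 1)) (X.X i j l)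
    have hγ₁ : ∀ l i j x, γ l (i + 1) j (X.d₁ i j (l + 1) x) = -W.d₁ i j l (γ l i j x) := by
      intro l i j x
      have h : (LinearMap.inl k _ _ (X.d₁ i j (l + 1) x) : X.X (i + 1) j (l + 1) × X.X (i + 1) j l)
          = -(coind X).d₁ i j l (LinearMap.inl k _ _ x) :=
        Prod.ext (neg_neg _).symm (by
          change 0 = -X.d₁ i j l 0; rw [map_zero, neg_zero])
      exact (congrArg (g.f (i + 1) j l) h).trans
        ((map_neg _ _).trans (congrArg _ (g.comm₁ i j l _)))
    have hγ₂ : ∀ l i j x, γ l i (j + 1) (X.d₂ i j (l + 1) x) = -W.d₂ i j l (γ l i j x) := by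
      intro l i j x
      have h : (LinearMap.inl k _ _ (X.d₂ i j (l + 1) x) : X.X i (j + 1) (l + 1) × X.X i (j + 1) l)
          = -(coind X).d₂ i j l (LinearMap.inl k _ _ x) :=
        Prod.ext (neg_neg _).symm (by
          change 0 = -X.d₂ i j l 0; rw [map_zero, neg_zero])
      exact (congrArg (g.f i (j + 1) l) h).trans
        ((map_neg _ _).trans (congrArg _ (g.comm₂ i j l _)))
    choose δ hδ₁ hδ₂ hδ using fun l => hX Z W e (l + 1) l (γ l) (hγ₁ l) (hγ₂ l)
    obtain ⟨f, hf⟩ := exists_hom_coind (fun i j l => δ l i j) (fun i j l => hδ₁ l i j)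
      (fun i j l => hδ₂ l i j)
    refine ⟨f, ?_⟩
    ext i j l ⟨a, b⟩
    obtain ⟨m, rfl⟩ : ∃ m, l = m + 1 := ⟨l - 1, by ring⟩
    refine (congrArg (e.f i j (m + 1)) (hf i j m a b)).trans ?_
    rw [map_add, e.comm₃, hδ, hδ]
    -- The second summand is matched through `(0, b) = ∂₃ (b, 0)`.
    refine (congrArg (γ (m + 1) i j a + ·) (g.comm₃ i j m (b, 0)).symm).trans ?_
    refine (map_add (g.f i j (m + 1)) _ _).symm.trans (congrArg (g.f i j (m + 1)) ?_)
    exact Prod.ext (add_zero a) (zero_add b)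

end Tricomplex

/-! ### Signs, and the rows of complexes of projectives -/

theorem negOnePow_succ_sub (i j : ℤ) : (i + 1 - j).negOnePow = -(i - j).negOnePow := by
  rw [← Int.negOnePow_succ]; congr 1; ring

theorem negOnePow_sub_succ (i j : ℤ) : (i - (j + 1)).negOnePow = -(i - j).negOnePow := by
  rw [← Int.negOnePow_succ, Int.negOnePow_eq_iff]
  exact ⟨-1, by ring⟩

theorem units_smul_smul {V : Type*} [AddCommGroup V] (s : ℤˣ) (v : V) : s • s • v = v := by
  rw [smul_smul, Int.units_mul_self, one_smul]

theorem map_units_smul {V W : Type*} [AddCommGroup V] [AddCommGroup W] [Module k V] [Module k W]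
    (f : V →ₗ[k] W) (s : ℤˣ) (v : V) : f (s • v) = s • f v := by
  rw [Units.smul_def, Units.smul_def, map_zsmul]

/-- The lifting property of `exists_lift_row` for anticommuting families. -/
theorem exists_lift_row_neg (M : GrMod k) [Projective M] {Z W : Tricomplex k} (e : Z ⟶ W)
    [Epi e] (l : ℤ) (γ : ∀ i j, M.comp (i - j) j →ₗ[k] W.X i j l)
    (hr : ∀ i j (v : M.comp (i - j) j), γ (i + 1) j ⟨M.act (A.right k (i - j)) v,
      M.act_right_mem (by ring) v.2⟩ = -W.d₁ i j l (γ i j v))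
    (hl : ∀ i j (v : M.comp (i - j) j), γ i (j + 1) ((i - j).negOnePow •
      ⟨M.act (A.left k (i - j)) v, M.act_left_mem (by ring) v.2⟩) = -W.d₂ i j l (γ i j v)) :
    ∃ δ : ∀ i j, M.comp (i - j) j →ₗ[k] Z.X i j l,
      (∀ i j (v : M.comp (i - j) j), δ (i + 1) j ⟨M.act (A.right k (i - j)) v,
        M.act_right_mem (by ring) v.2⟩ = -Z.d₁ i j l (δ i j v)) ∧
      (∀ i j (v : M.comp (i - j) j), δ i (j + 1) ((i - j).negOnePow •
        ⟨M.act (A.left k (i - j)) v, M.act_left_mem (by ring) v.2⟩) =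
          -Z.d₂ i j l (δ i j v)) ∧
      ∀ i j v, e.f i j l (δ i j v) = γ i j v := by
  -- Both arrows flip the parity of `i - j`, so the factor `(-1)^(i-j)` converts anticommuting
  -- families into `A`-linear ones; the same factor converts the lift back.
  obtain ⟨δ, hδr, hδl, hδ⟩ := exists_lift_row M e l (fun i j => (i - j).negOnePow • γ i j)
    (fun i j v => by
      rw [LinearMap.smul_apply, LinearMap.smul_apply, hr, map_units_smul, negOnePow_succ_sub,
        Units.neg_smul, smul_neg, neg_neg])
    (fun i j v => by
      have h := hl i j v
      rw [map_units_smul] at h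
      rw [LinearMap.smul_apply, LinearMap.smul_apply, map_units_smul, units_smul_smul,
        negOnePow_sub_succ, Units.neg_smul, h, neg_neg])
  refine ⟨fun i j => (i - j).negOnePow • δ i j, fun i j v => ?_, fun i j v => ?_,
    fun i j v => ?_⟩
  · rw [LinearMap.smul_apply, LinearMap.smul_apply, hδr, map_units_smul, negOnePow_succ_sub,
      Units.neg_smul]
  · rw [LinearMap.smul_apply, LinearMap.smul_apply, map_units_smul, hδl, map_units_smul,
      negOnePow_sub_succ, Units.neg_smul, units_smul_smul]
  · rw [LinearMap.smul_apply, map_units_smul, hδ, LinearMap.smul_apply, units_smul_smul]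

theorem rowLifting_GinfObj {M : Cx k} (hM : termwiseProjective k M) :
    Tricomplex.RowLifting (GinfObj M) := fun _ _ e _ l m γ h₁ h₂ =>
  have := hM l
  exists_lift_row_neg (M.X l) e m γ h₁ h₂

/-! ### Fullness on the level of complexes -/

/-- Maps of components that commute with the arrows come from a homomorphism of graded
modules. -/
theorem GrMod.exists_hom {M N : GrMod k}
    (φ : ∀ i j, M.comp (i - j) j →ₗ[k] N.comp (i - j) j)
    (hr : ∀ i j (v : M.comp (i - j) j), (φ (i + 1) j ⟨M.act (A.right k (i - j)) v,
      M.act_right_mem (by ring) v.2⟩ : N.V) = N.act (A.right k (i - j)) (φ i j v))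
    (hl : ∀ i j (v : M.comp (i - j) j), (φ i (j + 1) ⟨M.act (A.left k (i - j)) v,
      M.act_left_mem (by ring) v.2⟩ : N.V) = N.act (A.left k (i - j)) (φ i j v)) :
    ∃ f : M ⟶ N, ∀ i j (v : M.comp (i - j) j), f.toLin v = φ i j v := by
  obtain ⟨f, hf⟩ := GrMod.exists_linearMap (M := M)
    (fun i j => (N.comp (i - j) j).subtype ∘ₗ φ i j)
  have hf' : ∀ i j (v : M.V) (hv : v ∈ M.comp (i - j) j), f v = φ i j ⟨v, hv⟩ :=
    fun i j v hv => hf i j ⟨v, hv⟩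
  obtain ⟨g, rfl⟩ := GrMod.exists_hom_of_linearMap (M := M) (N := N) f
    (fun i j v hv => by
      rw [hf' i j v hv]
      exact (φ i j _).2)
    (fun i j v hv => by
      rw [hf' i j v hv, hf' (i + 1) j _ (M.act_right_mem (by ring) hv)]
      exact hr i j ⟨v, hv⟩)
    (fun i j v hv => by
      rw [hf' i j v hv, hf' i (j + 1) _ (M.act_left_mem (by ring) hv)]
      exact hl i j ⟨v, hv⟩)
  exact ⟨g, hf⟩

namespace GinfObj

variable {M N : Cx k} {i j l m : ℤ}

/-- The element of the graded module underlying an element of the tricomplex. -/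
def val (x : (GinfObj M).X i j l) : (M.X l).V :=
  Subtype.val (p := (· ∈ (M.X l).comp (i - j) j)) x

theorem val_injective {x y : (GinfObj M).X i j l} (h : val x = val y) : x = y :=
  Subtype.ext h

theorem exists_val_eq {v : (M.X l).V} (hv : v ∈ (M.X l).comp (i - j) j) :
    ∃ x : (GinfObj M).X i j l, val x = v := ⟨⟨v, hv⟩, rfl⟩

theorem val_add (x y : (GinfObj M).X i j l) : val (x + y) = val x + val y := rfl

theorem val_smul (s : ℤˣ) (x : (GinfObj M).X i j l) : val (s • x) = s • val x := rfl

theorem val_d₂ (x : (GinfObj M).X i j l) :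
    val ((GinfObj M).d₂ i j l x) =
      (i - j).negOnePow • (M.X l).act (A.left k (i - j)) (val x) := rfl

theorem val_d₃ (x : (GinfObj M).X i j l) :
    val ((GinfObj M).d₃ i j l x) = (i - j).negOnePow • (M.d l (l + 1)).toLin (val x) := rfl

/-- Maps between the rows of the tricomplexes of two complexes that commute with `∂₁` and
`∂₂` come from homomorphisms of graded modules. -/
theorem exists_hom_row (φ : ∀ i j, (GinfObj M).X i j l →ₗ[k] (GinfObj N).X i j m)
    (h₁ : ∀ i j x, φ (i + 1) j ((GinfObj M).d₁ i j l x) = (GinfObj N).d₁ i j m (φ i j x))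
    (h₂ : ∀ i j x, φ i (j + 1) ((GinfObj M).d₂ i j l x) = (GinfObj N).d₂ i j m (φ i j x)) :
    ∃ f : M.X l ⟶ N.X m, ∀ i j (x : (GinfObj M).X i j l),
      f.toLin (val x) = val (φ i j x) := by
  refine GrMod.exists_hom (fun i j => φ i j) (fun i j x => congrArg val (h₁ i j x))
    (fun i j x => ?_)
  have h : φ i (j + 1) ((i - j).negOnePow • (GinfObj M).d₂ i j l x) =
      (i - j).negOnePow • (GinfObj N).d₂ i j m (φ i j x) := by
    rw [map_units_smul]
    exact congrArg _ (h₂ i j x)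
  have hM : (i - j).negOnePow • (GinfObj M).d₂ i j l x = (⟨(M.X l).act (A.left k (i - j)) x,
      (M.X l).act_left_mem (by ring) x.2⟩ : (M.X l).comp (i - (j + 1)) (j + 1)) :=
    units_smul_smul _ _
  refine (congrArg (fun y => val (φ i (j + 1) y)) hM.symm).trans ((congrArg val h).trans ?_)
  rw [val_smul, val_d₂, units_smul_smul]
  rfl

theorem exists_map_eq (F : GinfObj M ⟶ GinfObj N) : ∃ f : M ⟶ N, (Ginf k).map f = F := by
  choose f hf using fun l => exists_hom_row (fun i j => F.f i j l) (fun i j => F.comm₁ i j l)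
    (fun i j => F.comm₂ i j l)
  refine ⟨⟨f, ?_⟩, ?_⟩
  · rintro l _ rfl
    refine GrMod.hom_ext_comp fun i j v hv => ?_
    obtain ⟨x, rfl⟩ := exists_val_eq hv
    -- Evaluating at `(-1)^(i-j) x` cancels the sign of `∂₃`.
    have h := congrArg val (F.comm₃ i j l ((i - j).negOnePow • x))
    rw [← hf, val_d₃, val_d₃, ← hf, val_smul] at h
    simp only [map_units_smul, units_smul_smul] at h
    exact h.symm
  · ext i j l x
    exact val_injective (hf l i j x)

end GinfObj

instance full_Ginf : (Ginf k).Full where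
  map_surjective F := GinfObj.exists_map_eq F

/-! ### Chain homotopies and null morphisms -/

/-- The functor `Ginf` sends null-homotopic chain maps to null morphisms. -/
theorem null_of_homotopy {M N : Cx k} {f : M ⟶ N} (h : Homotopy f 0) :
    Tricomplex.Null ((Ginf k).map f) := by
  -- The sign makes the `A`-linear homotopy anticommute with `∂₁` and `∂₂`. It cancels against the
  -- sign of `∂₃` in the homotopy formula, since `∂₃` does not change `i - j`.
  refine ⟨fun i j l => (i - j).negOnePow • ((h.hom (l + 1) l).toLin.restrict
    (fun _ hv => GrMod.Hom.map_comp (h.hom (l + 1) l) hv) :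
      (M.X (l + 1)).comp (i - j) j →ₗ[k] (N.X l).comp (i - j) j),
    fun i j l x => Subtype.ext ?_, fun i j l x => Subtype.ext ?_, fun i j l x => Subtype.ext ?_⟩
  · change (i + 1 - j).negOnePow • (h.hom (l + 1) l).toLin
        ((M.X (l + 1)).act (A.right k (i - j)) x.1) =
      -(N.X l).act (A.right k (i - j)) ((i - j).negOnePow • (h.hom (l + 1) l).toLin x.1)
    rw [GrMod.Hom.map_act, map_units_smul, negOnePow_succ_sub, Units.neg_smul]
  · change (i - (j + 1)).negOnePow • (h.hom (l + 1) l).toLin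
        ((i - j).negOnePow • (M.X (l + 1)).act (A.left k (i - j)) x.1) =
      -((i - j).negOnePow • (N.X l).act (A.left k (i - j))
        ((i - j).negOnePow • (h.hom (l + 1) l).toLin x.1))
    rw [map_units_smul, map_units_smul, GrMod.Hom.map_act, negOnePow_sub_succ, Units.neg_smul]
  · change (f.f (l + 1)).toLin x.1 =
      (i - j).negOnePow • (h.hom (l + 1 + 1) (l + 1)).toLin
        ((i - j).negOnePow • (M.d (l + 1) (l + 1 + 1)).toLin x.1) +
      (i - j).negOnePow • (N.d l (l + 1)).toLin
        ((i - j).negOnePow • (h.hom (l + 1) l).toLin x.1)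
    rw [map_units_smul, map_units_smul, units_smul_smul, units_smul_smul, h.comm (l + 1),
      dNext_eq h.hom (i' := l + 1 + 1) rfl, prevD_eq h.hom (j' := l) rfl]
    simp

/-- Chain maps whose tricomplex morphism is null are null-homotopic. -/
theorem homotopy_of_null {M N : Cx k} {f : M ⟶ N} (h : Tricomplex.Null ((Ginf k).map f)) :
    Nonempty (Homotopy f 0) := by
  obtain ⟨v, h₁, h₂, h₃⟩ : Tricomplex.Null (X := GinfObj M) (Y := GinfObj N)
    ((Ginf k).map f) := h
  choose w hw using fun l => GinfObj.exists_hom_row (fun i j => (i - j).negOnePow • v i j l)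
    (fun i j x => by
      rw [LinearMap.smul_apply, LinearMap.smul_apply, h₁, map_units_smul, negOnePow_succ_sub,
        Units.neg_smul, smul_neg, neg_neg])
    (fun i j x => by
      rw [LinearMap.smul_apply, LinearMap.smul_apply, h₂, map_units_smul, negOnePow_sub_succ,
        Units.neg_smul, smul_neg, neg_neg])
  -- `w l` goes from degree `l + 1` to degree `l`; a chain homotopy needs maps between all pairs of
  -- degrees, set to zero off this diagonal.
  obtain ⟨H, hH⟩ := exists_eq_succ (P := fun l => ∀ m, M.X l ⟶ N.X m)
    (fun l m => if hm : l = m then w l ≫ eqToHom (by rw [hm]) else 0)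
  refine ⟨⟨H, fun l m hlm => ?_, fun l => ?_⟩⟩
  · obtain ⟨l, rfl⟩ : ∃ l', l = l' + 1 := ⟨l - 1, by ring⟩
    rw [hH]
    refine dif_neg ?_
    rintro rfl
    exact hlm rfl
  · obtain ⟨l, rfl⟩ : ∃ l', l = l' + 1 := ⟨l - 1, by ring⟩
    have hH' : ∀ l, H (l + 1) l = w l := fun l => by
      refine (congrFun (hH l) l).trans ((dif_pos rfl).trans ?_)
      rw [eqToHom_refl, Category.comp_id]
    rw [dNext_eq H (i' := l + 1 + 1) rfl, prevD_eq H (j' := l) rfl, hH', hH',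
      HomologicalComplex.zero_f, add_zero]
    refine GrMod.hom_ext_comp fun i j x hx => ?_
    obtain ⟨x, rfl⟩ := GinfObj.exists_val_eq hx
    have h : (f.f (l + 1)).toLin (GinfObj.val x) = GinfObj.val (v i j (l + 1)
        ((GinfObj M).d₃ i j (l + 1) x) + (GinfObj N).d₃ i j l (v i j l x)) :=
      congrArg GinfObj.val (h₃ i j l x)
    have hd : (M.d (l + 1) (l + 1 + 1)).toLin (GinfObj.val x) =
        GinfObj.val ((i - j).negOnePow • (GinfObj M).d₃ i j (l + 1) x) := by
      rw [GinfObj.val_smul, GinfObj.val_d₃, units_smul_smul]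
    rw [GinfObj.val_add, GinfObj.val_d₃] at h
    change _ = (w (l + 1)).toLin ((M.d (l + 1) (l + 1 + 1)).toLin (GinfObj.val x)) +
      (N.d l (l + 1)).toLin ((w l).toLin (GinfObj.val x))
    rw [h, hd, hw, hw, LinearMap.smul_apply, LinearMap.smul_apply, map_units_smul,
      units_smul_smul, GinfObj.val_smul, map_units_smul]

/-- Homotopic chain maps between complexes of projective modules become equal in the stable
category. -/
theorem stable_eq_of_homotopy {M N : Cx k} (hM : termwiseProjective k M) {f g : M ⟶ N}
    (h : Homotopy f g) :
    (SM3.quotient k).map ((Ginf k).map f) = (SM3.quotient k).map ((Ginf k).map g) := by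
  obtain ⟨b, hb⟩ := (null_of_homotopy (Homotopy.equivSubZero h)).exists_factor
  -- The projective object is the coinduced tricomplex of the source, which is why `M` must be
  -- termwise projective.
  refine CategoryTheory.Quotient.sound _ ⟨_, (rowLifting_GinfObj hM).projective_coind,
    Tricomplex.toCoind _, b, ?_⟩
  refine Eq.trans ?_ hb
  ext i j l x
  rw [sub_eq_add_neg, sub_eq_add_neg]
  rfl

/-- Chain maps that become equal in the stable category are homotopic. -/
theorem homotopic_of_stable_eq {M N : Cx k} {f g : M ⟶ N}
    (h : (SM3.quotient k).map ((Ginf k).map f) = (SM3.quotient k).map ((Ginf k).map g)) :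
    Nonempty (Homotopy f g) := by
  have h' : (Ginf k).map f - (Ginf k).map g = (Ginf k).map (f - g) := by
    ext i j l x
    rw [sub_eq_add_neg, sub_eq_add_neg]
    rfl
  exact (homotopy_of_null (h' ▸ Tricomplex.null_of_stable_eq h)).map
    Homotopy.equivSubZero.symm

/-! ### The functor on the homotopy category -/

variable (k) in
/-- The functor on the homotopy category induced by `Ginf`. -/
def stableGinf : HoProj k ⥤ SM3 k where
  obj M := (SM3.quotient k).obj ((Ginf k).obj M.obj.as)
  map f := (SM3.quotient k).map ((Ginf k).map (Quot.out f.hom))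
  map_id M :=
    (stable_eq_of_homotopy M.property (HomotopyCategory.homotopyOfEq _ _
      (HomotopyCategory.quotient_map_out (𝟙 M.obj)))).trans
      ((congrArg _ ((Ginf k).map_id _)).trans ((SM3.quotient k).map_id _))
  map_comp {M _ _} f g :=
    (stable_eq_of_homotopy M.property (HomotopyCategory.homotopyOfEq _ _
      ((HomotopyCategory.quotient_map_out (f.hom ≫ g.hom)).trans
        ((congrArg₂ (· ≫ ·) (HomotopyCategory.quotient_map_out f.hom).symm
          (HomotopyCategory.quotient_map_out g.hom).symm).trans
          ((HomotopyCategory.quotient _ _).map_comp _ _).symm)))).trans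
      ((congrArg _ ((Ginf k).map_comp _ _)).trans ((SM3.quotient k).map_comp _ _))

/-- The chosen representative of the class of `f` is homotopic to `f`, and homotopic maps agree
stably. -/
theorem stableGinf_map {M N : ProjCx k} (f : M ⟶ N) :
    (stableGinf k).map ((HoProj.quotient k).map f) =
      (SM3.quotient k).map ((Ginf k).map f.hom) :=
  stable_eq_of_homotopy M.property (HomotopyCategory.homotopyOfEq _ _
    (HomotopyCategory.quotient_map_out ((HomotopyCategory.quotient _ _).map f.hom)))

theorem quotient_map_surjective {M N : HoProj k} (f : M ⟶ N) :
    ∃ g : (⟨M.obj.as, M.property⟩ : ProjCx k) ⟶ ⟨N.obj.as, N.property⟩,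
      (HoProj.quotient k).map g = f :=
  ⟨ObjectProperty.homMk (Quot.out f.hom),
    ObjectProperty.hom_ext _ (HomotopyCategory.quotient_map_out f.hom)⟩

theorem quotient_comp_stableGinf : HoProj.quotient k ⋙ stableGinf k =
    (termwiseProjective k).ι ⋙ Ginf k ⋙ SM3.quotient k :=
  CategoryTheory.Functor.ext (fun _ => rfl) fun _ _ f =>
    (stableGinf_map f).trans ((Category.id_comp _).trans (Category.comp_id _)).symm

/-- Functors on the homotopy category are determined by their composition with the
projection. -/
theorem eq_of_quotient_comp_eq {G G' : HoProj k ⥤ SM3 k}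
    (h : HoProj.quotient k ⋙ G' = HoProj.quotient k ⋙ G) : G' = G :=
  CategoryTheory.Functor.ext (fun M => Functor.congr_obj h ⟨M.obj.as, M.property⟩) fun M N f => by
    obtain ⟨g, rfl⟩ := quotient_map_surjective f
    exact Functor.congr_hom h g

instance full_stableGinf : (stableGinf k).Full where
  map_surjective {M N} F := by
    obtain ⟨F, rfl⟩ := (SM3.quotient k).map_surjective F
    obtain ⟨f, rfl⟩ := (Ginf k).map_surjective F
    exact ⟨_, stableGinf_map (M := ⟨M.obj.as, M.property⟩) (N := ⟨N.obj.as, N.property⟩)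
      (ObjectProperty.homMk f)⟩

instance faithful_stableGinf : (stableGinf k).Faithful where
  map_injective {M N} f g h := by
    obtain ⟨f, rfl⟩ := quotient_map_surjective f
    obtain ⟨g, rfl⟩ := quotient_map_surjective g
    obtain ⟨H⟩ := homotopic_of_stable_eq
      ((stableGinf_map f).symm.trans (h.trans (stableGinf_map g)))
    exact ObjectProperty.hom_ext _ (HomotopyCategory.eq_of_homotopy _ _ H)

end Zigzag

end

theorem mainTheorem3 (k : Type u) [Field k] :
    ∃ G : Zigzag.HoProj k ⥤ Zigzag.SM3 k,
      (Zigzag.HoProj.quotient k ⋙ G =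
        (Zigzag.termwiseProjective k).ι ⋙ Zigzag.Ginf k ⋙ Zigzag.SM3.quotient k) ∧
      (∀ G' : Zigzag.HoProj k ⥤ Zigzag.SM3 k,
        Zigzag.HoProj.quotient k ⋙ G' =
          (Zigzag.termwiseProjective k).ι ⋙ Zigzag.Ginf k ⋙ Zigzag.SM3.quotient k → G' = G) ∧
      G.Full ∧ G.Faithful :=
  ⟨Zigzag.stableGinf k, Zigzag.quotient_comp_stableGinf,
    fun _ h => Zigzag.eq_of_quotient_comp_eq (h.trans Zigzag.quotient_comp_stableGinf.symm),
    Zigzag.full_stableGinf, Zigzag.faithful_stableGinf⟩
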